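/- **Setting.** Let $m\ge 1$ and, for $i=1,\dots,m$, let $F_i$ be a Borel probability measure on a second countable $T_1$ space with support $\Xi_i$; let $\mathcal P_i$ be the convex hull of $F_i$ and the Dirac measures at points of $\Xi_i$, and $\mathcal P=\prod_i\mathcal P_i$. Let $\psi$ be a real-valued performance measure on $\mathcal P$ that can be simulated without bias: for each $P=(P_1,\dots,P_m)\in\mathcal P$ a simulation replication $\hat\psi_r(P)$ is an integrable real random variable whose law depends only on $P$ and whose mean is $\psi(P)$. Put $\tau^2(P)=\mathbb E_P[(\hat\psi_r-\psi(P))^2]$ and $\mu_4(P)=\mathbb E_P[(\hat\psi_r-\psi(P))^4]$. For each $i$ let $X_{i,1},X_{i,2},\dots$ be i.i.d. with law $F_i$, independent over $i$. Consider data sizes $n_1,\dots,n_m\to\infty$ (along a sequence), $n=\frac1m\sum_i n_i$, the empirical distributions $\widehat F_i=\frac1{n_i}\sum_{j=1}^{n_i}\delta_{X_{i,j}}$, and the input variance $\sigma_I^2=\mathrm{Var}[\psi(\widehat F_1,\dots,\widehat F_m)]$. **Algorithm (proportionate subsampled variance bootstrap).** The parameters $B\ge2$, $R\ge2$, $0<\theta\le1$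 may depend on the data sizes. Let $s_i=\lfloor\theta n_i\rfloor$ and $s=\frac1m\sum_i s_i$. For $b=1,\dots,B$, independently: for each $i$ draw $s_i$ points uniformly with replacement from $\{X_{i,1},\dots,X_{i,n_i}\}$ (independently over $i$), let $\widehat F^b_{s_i,i}$ be their empirical distribution, and, conditionally on these, generate $R$ independent replications $\hat\psi_r^b=\hat\psi_r(\widehat F^b_{s_1,1},\dots,\widehat F^b_{s_m,m})$, $r=1,\dots,R$. With $\bar\psi^b=\frac1R\sum_r\hat\psi^b_r$, $\bar{\bar\psi}=\frac1B\sum_b\bar\psi^b$ and $V=\frac1{B(R-1)}\sum_b\sum_r(\hat\psi_r^b-\bar\psi^b)^2$, output $$\hat\sigma^2_{SVB}=\theta\Big(\frac1{B-1}\sum_{b=1}^B(\bar\psi^b-\bar{\bar\psi})^2-\frac VR\Big).$$ Let $\widehat F^*_{s_i,i}$ denote a generic resampled distribution of size $s_i$ (independent over $i$ given the data), and $\mathbb E_*$ the expectation over the resampling, conditional on the data. **Assumptions.** 1. (Balanced data) For some finite $c>0$, $\max_i n_i/\min_i n_i\le c$ as $n_i\to\infty$. 2. (First order differentiability) There are functions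 $g_i(P;\cdot):\Xi_i\to\mathbb R$ ($P\in\mathcal P$), integrable with respect to every element of $\mathcal P_i$, with $\mathbb E_{P_i}[g_i(P;X_i)]=0$, such that for all $P,Q\in\mathcal P$, with $P_i^{\nu_i}=(1-\nu_i)P_i+\nu_iQ_i$, as $\nu_1,\dots,\nu_m\in[0,1]$ all tend to $0$, $$\psi(P_1^{\nu_1},\dots,P_m^{\nu_m})-\psi(P)=\sum_{i=1}^m\nu_i\int g_i(P;x)\,d(Q_i-P_i)(x)+o\Big(\sqrt{\textstyle\sum_i\nu_i^2}\Big).$$ 3. (Smoothness at the true inputs) With $g_i=g_i(F_1,\dots,F_m;\cdot)$, the remainder $\epsilon=\psi(\widehat F_1,\dots,\widehat F_m)-\psi(F_1,\dots,F_m)-\sum_i\int g_i\,d(\widehat F_i-F_i)$ satisfies $\mathbb E[\epsilon^2]=o(n^{-1})$; moreover $\sigma_i^2=\mathrm{Var}_{F_i}[g_i(X_i)]>0$ and $\mathbb E_{F_i}[g_i^4(X_i)]<\infty$ for all $i$. 4. (Smoothness at the empirical inputs) With $\hat g_i=g_i(\widehat F_1,\dots,\widehat F_m;\cdot)$, $\mathbb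 E[(\hat g_i-g_i)^4(X_{i,1})]\to0$ for all $i$; and for every $(\overline F_1,\dots,\overline F_m)\in\prod_i\{\widehat F_i,\widehat F^*_{s_i,i}\}$ the remainder $\epsilon^*=\psi(\overline F_1,\dots,\overline F_m)-\psi(\widehat F_1,\dots,\widehat F_m)-\sum_i\int\hat g_i\,d(\overline F_i-\widehat F_i)$ satisfies $\mathbb E_*[(\epsilon^*)^4]=o_p(s^{-2})$. 5. $\tau^2(F_1,\dots,F_m)<\infty$ and $\hat\tau^2:=\tau^2(\widehat F_1,\dots,\widehat F_m)\to_p\tau^2(F_1,\dots,F_m)$. 6. $\mathbb E_*[(\tau^2(\overline F_1,\dots,\overline F_m)-\hat\tau^2)^2]=o_p(1)$ for every $(\overline F_1,\dots,\overline F_m)\in\prod_i\{\widehat F_i,\widehat F^*_{s_i,i}\}$. 7. $\mathbb E_*[\mu_4(\overline F_1,\dots,\overline F_m)]=O_p(1)$ for every $(\overline F_1,\dots,\overline F_m)\in\prod_i\{\widehat F_i,\widehat F^*_{s_i,i}\}$. **Theorem.** Under Assumptions 1–7, if $B\to\infty$, $BR^2/(\theta n)^2\to\infty$ and $\theta n\to\infty$,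 then $\hat\sigma^2_{SVB}$ is relatively consistent: $$\hat\sigma^2_{SVB}/\sigma_I^2\ \stackrel{p}{\longrightarrow}\ 1 .$$ (The law of a replication driven by empirical distributions, and the influence functions at empirical distributions, are assumed to depend measurably on the data points.) -/

import Mathlib

open MeasureTheory ProbabilityTheory Filter Topology Asymptotics
open scoped ENNReal NNReal

noncomputable section

namespace InputUncertainty

universe u v

/-- The empirical distribution `(1/s) ∑ δ_{x_l}` of the points `x_1, …, x_s`. -/
def empirical {α : Type u} [MeasurableSpace α] {s : ℕ} (x : Fin s → α) : Measure α :=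
  (s : ℝ≥0∞)⁻¹ • ∑ l, Measure.dirac (x l)

/-- The convex hull of `F` and of the Dirac measures at the points of the support of `F`. -/
def hullClass {α : Type u} [TopologicalSpace α] [MeasurableSpace α] (F : Measure α) :
    Set (Measure α) :=
  {P | ∃ (l : ℕ) (a : ℝ≥0) (w : Fin l → ℝ≥0) (x : Fin l → α),
    (∀ k, x k ∈ F.support) ∧ a + ∑ k, w k = 1 ∧ P = a • F + ∑ k, w k • Measure.dirac (x k)}

section Inputs

variable {m : ℕ} {E : Fin m → Type u} [∀ i, MeasurableSpace (E i)]

/-- The empirical input models built from the first `n i` observations of each input. -/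
def empiricalInput (n : Fin m → ℕ) (x : ∀ i, ℕ → E i) : ∀ i, Measure (E i) :=
  fun i => empirical fun j : Fin (n i) => x i j

/-- Which observations are drawn in one resample: `s i` draws (with replacement) from the
`n i` observations of input `i`, for each `i`. -/
abbrev ResampleIndex (n s : Fin m → ℕ) : Type := ∀ i, Fin (s i) → Fin (n i)

/-- The resampled input models, i.e. the empirical distributions of the drawn points. -/
def resampledInput {n s : Fin m → ℕ} (x : ∀ i, ℕ → E i) (J : ResampleIndex n s) :
    ∀ i, Measure (E i) :=
  fun i => empirical fun l : Fin (s i) => x i (J i l)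

/-- The input models that are resampled for `i ∈ T` and empirical for `i ∉ T`. -/
def mixedInput {n s : Fin m → ℕ} (T : Finset (Fin m)) (x : ∀ i, ℕ → E i)
    (J : ResampleIndex n s) : ∀ i, Measure (E i) :=
  fun i => if i ∈ T then resampledInput x J i else empiricalInput n x i

/-- The expectation over one resample, conditional on the data: the average over all
equally likely draws. -/
def starMean {n s : Fin m → ℕ} (f : ResampleIndex n s → ℝ) : ℝ :=
  (∑ J, f J) / (Fintype.card (ResampleIndex n s) : ℝ)

/-- `starMean` for quantities with values in `[0, ∞]`. -/
def starMeanENN {n s : Fin m → ℕ} (f : ResampleIndex n s → ℝ≥0∞) : ℝ≥0∞ :=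
  (∑ J, f J) / (Fintype.card (ResampleIndex n s) : ℝ≥0∞)

/-- The average size `(1/m) ∑ n_i`. -/
def avgSize (n : Fin m → ℕ) : ℝ := (∑ i, (n i : ℝ)) / (m : ℝ)

/-- The subsample sizes `s_i = ⌊θ n_i⌋`. -/
def subsampleSize (θ : ℝ) (n : Fin m → ℕ) : Fin m → ℕ := fun i => ⌊θ * (n i : ℝ)⌋₊

/-- The remainder of the first order expansion of `ψ` around `P`, evaluated at `Q`, where
`g i P` is the `i`-th influence function at `P`. -/
def remainder (ψ : (∀ i, Measure (E i)) → ℝ) (g : ∀ i, (∀ i, Measure (E i)) → E i → ℝ)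
    (P Q : ∀ i, Measure (E i)) : ℝ :=
  ψ Q - ψ P - ∑ i, (∫ x, g i P x ∂(Q i) - ∫ x, g i P x ∂(P i))

/-- The variance of one simulation replication, whose law under the input models `P` is
`S P` and whose mean is `ψ P`. -/
def simVar (ψ : (∀ i, Measure (E i)) → ℝ) (S : (∀ i, Measure (E i)) → Measure ℝ)
    (P : ∀ i, Measure (E i)) : ℝ :=
  ∫ y, (y - ψ P) ^ 2 ∂(S P)

/-- The fourth central moment of one simulation replication (possibly infinite). -/
def simMoment4 (ψ : (∀ i, Measure (E i)) → ℝ) (S : (∀ i, Measure (E i)) → Measure ℝ)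
    (P : ∀ i, Measure (E i)) : ℝ≥0∞ :=
  ∫⁻ y, ‖y - ψ P‖ₑ ^ 4 ∂(S P)

end Inputs

/-- `A = O_p(1)` for random variables with values in `[0, ∞]`. -/
def IsBigOpOne {Ω : Type v} [MeasurableSpace Ω] (μ : Measure Ω) (A : ℕ → Ω → ℝ≥0∞) : Prop :=
  ∀ ε : ℝ≥0∞, 0 < ε → ∃ M : ℝ≥0, ∀ᶠ k in atTop, μ {ω | (M : ℝ≥0∞) < A k ω} < ε

section Estimator

variable {B R : ℕ}

/-- The mean of the `R` replications in group `b`. -/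
def groupMean (y : Fin B → Fin R → ℝ) (b : Fin B) : ℝ := (∑ r, y b r) / (R : ℝ)

/-- The grand mean. -/
def grandMean (y : Fin B → Fin R → ℝ) : ℝ := (∑ b, groupMean y b) / (B : ℝ)

/-- The within-group variance `V`. -/
def withinVar (y : Fin B → Fin R → ℝ) : ℝ :=
  (∑ b, ∑ r, (y b r - groupMean y b) ^ 2) / ((B : ℝ) * ((R : ℝ) - 1))

/-- The output of the proportionate subsampled variance bootstrap with subsample ratio `θ`,
computed from the replications `y b r`. -/
def svbEstimator (θ : ℝ) (y : Fin B → Fin R → ℝ) : ℝ :=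
  θ * ((∑ b, (groupMean y b - grandMean y) ^ 2) / ((B : ℝ) - 1) - withinVar y / (R : ℝ))

end Estimator

section Model

variable {m : ℕ} {E : Fin m → Type u} [∀ i, MeasurableSpace (E i)]

/-- The observations `X i 0, X i 1, …` of input `i` have law `F i`, and all observations of
all inputs are independent. -/
structure IsData {Ω : Type v} [MeasurableSpace Ω] (μ : Measure Ω) (F : ∀ i, Measure (E i))
    (X : ∀ i, ℕ → Ω → E i) : Prop where
  measurable : ∀ i j, Measurable (X i j)
  law : ∀ i j, μ.map (X i j) = F i
  indep : iIndepFun (fun (p : Fin m × ℕ) => X p.1 p.2) μ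

/-- The performance measure `ψ` can be simulated without bias on the product of the classes
`hullClass (F i)`: a replication driven by `P` has law `S P`, with mean `ψ P`. Replications
driven by empirical distributions depend measurably on the data points. -/
structure IsSimulator [∀ i, TopologicalSpace (E i)] (F : ∀ i, Measure (E i))
    (ψ : (∀ i, Measure (E i)) → ℝ) (S : (∀ i, Measure (E i)) → Measure ℝ) : Prop where
  prob : ∀ P : ∀ i, Measure (E i), (∀ i, P i ∈ hullClass (F i)) → IsProbabilityMeasure (S P)
  integrable : ∀ P : ∀ i, Measure (E i), (∀ i, P i ∈ hullClass (F i)) →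
    Integrable (fun y : ℝ => y) (S P)
  unbiased : ∀ P : ∀ i, Measure (E i), (∀ i, P i ∈ hullClass (F i)) → ∫ y, y ∂(S P) = ψ P
  measurable : ∀ s : Fin m → ℕ, (∀ i, 0 < s i) →
    Measurable fun x : ∀ i, Fin (s i) → E i => S fun i => empirical (x i)

/-- One run of the two-layer sampling. For each `b`, the index tuple `J ω b` is a uniform draw
with replacement, independently over `b` and of the data. Conditionally on the data and on all
draws, the replications `Y ω b r` are independent, and `Y ω b r` has the law `S` driven by the
`b`-th resampled input models. -/
structure IsRun {Ω : Type v} [MeasurableSpace Ω] (μ : Measure Ω)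
    (S : (∀ i, Measure (E i)) → Measure ℝ) (X : ∀ i, ℕ → Ω → E i) {n s : Fin m → ℕ} {B R : ℕ}
    (J : Ω → Fin B → ResampleIndex n s) (Y : Ω → Fin B → Fin R → ℝ) : Prop where
  measurable_index : Measurable J
  measurable_output : Measurable Y
  index_uniform : μ.map J = uniformOn Set.univ
  index_indep : IndepFun (fun ω i j => X i j ω) J μ
  output_law : ∀ A : Set ((∀ i, ℕ → E i) × (Fin B → ResampleIndex n s)), MeasurableSet A →
    ∀ C : Fin B → Fin R → Set ℝ, (∀ b r, MeasurableSet (C b r)) →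
      μ {ω | (fun i j => X i j ω, J ω) ∈ A ∧ ∀ b r, Y ω b r ∈ C b r} =
        ∫⁻ ω in {ω | (fun i j => X i j ω, J ω) ∈ A},
          ∏ b, ∏ r, S (resampledInput (fun i j => X i j ω) (J ω b)) (C b r) ∂μ

/-- Balanced data: all data sizes tend to infinity, with bounded ratios. -/
structure BalancedData (n : ℕ → Fin m → ℕ) : Prop where
  tendsto : ∀ i, Tendsto (fun k => n k i) atTop atTop
  ratio : ∃ c : ℝ, 0 < c ∧ ∀ᶠ k in atTop, ∀ i j, (n k i : ℝ) ≤ c * (n k j : ℝ)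

/-- First order (Gateaux) differentiability of `ψ` on the product of the classes
`hullClass (F i)`, with influence functions `g i P`. -/
structure GateauxDifferentiable [∀ i, TopologicalSpace (E i)] (F : ∀ i, Measure (E i))
    (ψ : (∀ i, Measure (E i)) → ℝ) (g : ∀ i, (∀ i, Measure (E i)) → E i → ℝ) : Prop where
  integrable : ∀ P Q : ∀ i, Measure (E i),
    (∀ i, P i ∈ hullClass (F i)) → (∀ i, Q i ∈ hullClass (F i)) →
    ∀ i, Integrable (g i P) (Q i)
  centered : ∀ P : ∀ i, Measure (E i), (∀ i, P i ∈ hullClass (F i)) → ∀ i, ∫ x, g i P x ∂(P i) = 0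
  expansion : ∀ P Q : ∀ i, Measure (E i),
    (∀ i, P i ∈ hullClass (F i)) → (∀ i, Q i ∈ hullClass (F i)) →
    (fun ν : Fin m → ℝ =>
      ψ (fun i => (1 - ν i).toNNReal • P i + (ν i).toNNReal • Q i) - ψ P
        - ∑ i, ν i * (∫ x, g i P x ∂(Q i) - ∫ x, g i P x ∂(P i)))
      =o[𝓝[Set.Icc 0 1] 0] fun ν => Real.sqrt (∑ i, ν i ^ 2)
  /-- The influence functions at empirical distributions depend measurably on the data. -/
  measurable : ∀ n : Fin m → ℕ, (∀ i, 0 < n i) → ∀ i,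
    Measurable fun z : (∀ i, Fin (n i) → E i) × E i => g i (fun i' => empirical (z.1 i')) z.2

/-- Smoothness at the true input models: `E[ε²] = o(1/n)`, and the influence functions at `F`
are non-degenerate with finite fourth moments. -/
structure SmoothAtTruth {Ω : Type v} [MeasurableSpace Ω] (μ : Measure Ω)
    (F : ∀ i, Measure (E i)) (ψ : (∀ i, Measure (E i)) → ℝ)
    (g : ∀ i, (∀ i, Measure (E i)) → E i → ℝ) (X : ∀ i, ℕ → Ω → E i) (n : ℕ → Fin m → ℕ) :
    Prop where
  remainder_small : Tendsto
    (fun k => ENNReal.ofReal (avgSize (n k)) *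
      ∫⁻ ω, ‖remainder ψ g F (empiricalInput (n k) fun i j => X i j ω)‖ₑ ^ 2 ∂μ)
    atTop (𝓝 0)
  nondegenerate : ∀ i, 0 < variance (g i F) (F i)
  moment4 : ∀ i, MemLp (g i F) 4 (F i)

/-- Smoothness at the empirical input models: `E[(ĝ_i - g_i)⁴(X_{i,1})] → 0`, and
`E_*[(ε^*)⁴] = o_p(s⁻²)` for every choice of empirical or resampled input models. -/
structure SmoothAtEmpirical {Ω : Type v} [MeasurableSpace Ω] (μ : Measure Ω)
    (F : ∀ i, Measure (E i)) (ψ : (∀ i, Measure (E i)) → ℝ)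
    (g : ∀ i, (∀ i, Measure (E i)) → E i → ℝ) (X : ∀ i, ℕ → Ω → E i)
    (n s : ℕ → Fin m → ℕ) : Prop where
  influence : ∀ i, Tendsto
    (fun k => ∫⁻ ω, ‖g i (empiricalInput (n k) fun i' j => X i' j ω) (X i 0 ω)
      - g i F (X i 0 ω)‖ₑ ^ 4 ∂μ)
    atTop (𝓝 0)
  remainder_small : ∀ T : Finset (Fin m), TendstoInMeasure μ
    (fun k ω => avgSize (s k) ^ 2 *
      starMean fun J : ResampleIndex (n k) (s k) =>
        remainder ψ g (empiricalInput (n k) fun i j => X i j ω)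
          (mixedInput T (fun i j => X i j ω) J) ^ 4)
    atTop (fun _ => (0 : ℝ))

/-- Convergence of the empirical variance: the simulation variance at the truth is finite,
and `τ̂² → τ²` in probability. -/
def EmpiricalVarConverges {Ω : Type v} [MeasurableSpace Ω] (μ : Measure Ω)
    (F : ∀ i, Measure (E i)) (ψ : (∀ i, Measure (E i)) → ℝ)
    (S : (∀ i, Measure (E i)) → Measure ℝ) (X : ∀ i, ℕ → Ω → E i) (n : ℕ → Fin m → ℕ) : Prop :=
  MemLp (fun y : ℝ => y) 2 (S F) ∧
  TendstoInMeasure μ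
    (fun k ω => simVar ψ S (empiricalInput (n k) fun i j => X i j ω))
    atTop (fun _ => simVar ψ S F)

/-- Convergence of the bootstrapped variance: `E_*[(τ²(F̄) - τ̂²)²] = o_p(1)` for every choice
of empirical or resampled input models. -/
def BootstrapVarConverges {Ω : Type v} [MeasurableSpace Ω] (μ : Measure Ω)
    (ψ : (∀ i, Measure (E i)) → ℝ) (S : (∀ i, Measure (E i)) → Measure ℝ)
    (X : ∀ i, ℕ → Ω → E i) (n s : ℕ → Fin m → ℕ) : Prop :=
  ∀ T : Finset (Fin m), TendstoInMeasure μ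
    (fun k ω => starMean fun J : ResampleIndex (n k) (s k) =>
      (simVar ψ S (mixedInput T (fun i j => X i j ω) J)
        - simVar ψ S (empiricalInput (n k) fun i j => X i j ω)) ^ 2)
    atTop (fun _ => (0 : ℝ))

/-- Boundedness of the fourth moment: `E_*[μ₄(F̄)] = O_p(1)` for every choice of empirical or
resampled input models. -/
def BootstrapMoment4Bounded {Ω : Type v} [MeasurableSpace Ω] (μ : Measure Ω)
    (ψ : (∀ i, Measure (E i)) → ℝ) (S : (∀ i, Measure (E i)) → Measure ℝ)
    (X : ∀ i, ℕ → Ω → E i) (n s : ℕ → Fin m → ℕ) : Prop :=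
  ∀ T : Finset (Fin m), IsBigOpOne μ
    (fun k ω => starMeanENN fun J : ResampleIndex (n k) (s k) =>
      simMoment4 ψ S (mixedInput T (fun i j => X i j ω) J))

/-- The input variance `σ_I² = Var[ψ(F̂_1, …, F̂_m)]`. -/
def inputVar {Ω : Type v} [MeasurableSpace Ω] (μ : Measure Ω) (ψ : (∀ i, Measure (E i)) → ℝ)
    (X : ∀ i, ℕ → Ω → E i) (n : Fin m → ℕ) : ℝ :=
  variance (fun ω => ψ (empiricalInput n fun i j => X i j ω)) μ

end Model

end InputUncertainty

end

open InputUncertainty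

open InputUncertainty

/-! Let v = ∑ σ_i²/n_i (`linearVar`) be the variance of the first order term of ψ(F̂) at the true
inputs. Both the input variance and the estimator are compared with v. Only v is ever used as a
yardstick, so no ratio n_i/n_j has to converge.

Input variance: ψ(F̂) is ψ(F) plus a sum of independent centred terms with variance v plus a
remainder of mean square o(1/n). Since 1/v = O(n), the remainder is negligible by Cauchy–Schwarz and
σ_I²/v → 1 (`tendsto_inputVar_div_linearVar`).

Target of the estimator: given the data, the same expansion at F̂ shows that the variance of ψ at
the resampled inputs is about ∑ σ̂_i²/s_i, where σ̂_i² is the empirical second moment of ĝ_i. The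
law of large numbers for g_i², together with the L⁴ closeness of ĝ_i and g_i, gives σ̂_i² → σ_i². As
s_i ~ θ n_i, θ times the conditional variance is asymptotic to v (`tendsto_starVar`).

Concentration: given the data, the B groups of replications are i.i.d. The correction V/R is an
unbiased estimate of the simulation noise in a group mean, so the estimator without the factor θ has
conditional expectation exactly equal to the conditional variance of ψ (`mixLaw_moments`). With t =
θ/v, Chebyshev's inequality bounds the conditional probability of a deviation by a constant times
1/B + t² M/B + t² K/(B R²), where M is the conditional fourth central moment of ψ at the resampled
inputs and K the mean fourth moment of the simulation noise (`svbEstimator_concentration`). Here t²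
M is bounded in probability by the linearization, K = O_p(1), and t = O(θ n), so the hypotheses on B
and R make the bound vanish.

Removing the conditioning: the joint law of data and output is the law of the data composed with a
Markov kernel (`map_data_output`). Conditional probabilities are at most 1, so their convergence to
0 in probability gives convergence of the unconditional probabilities. -/

namespace InputUncertainty

/-! ### Moments of sums of independent centred variables -/

/-- A function with a finite fourth moment has integrable lower powers. -/
theorem integrable_pow_of_memLp_four {Ω : Type*} [MeasurableSpace Ω] {μ : Measure Ω}
    [IsFiniteMeasure μ] {f : Ω → ℝ} (hf : MemLp f 4 μ) {k : ℕ} (hk : k ≤ 4) :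
    Integrable (fun ω => f ω ^ k) μ := by
  have h4 : Integrable (fun ω => ‖f ω‖ ^ 4) μ := by
    have := hf.integrable_norm_pow (p := 4) (by norm_num)
    simpa using this
  refine ((integrable_const (1 : ℝ)).add h4).mono' (hf.aestronglyMeasurable.pow k)
    (ae_of_all _ fun ω => ?_)
  simp only [norm_pow, Pi.add_apply]
  rcases le_total ‖f ω‖ 1 with h | h
  · have := pow_le_one₀ (n := k) (norm_nonneg (f ω)) h
    have : (0 : ℝ) ≤ ‖f ω‖ ^ 4 := by positivity
    linarith
  · have := pow_le_pow_right₀ h hk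
    linarith

theorem memLp_four_of_integrable {Ω : Type*} [MeasurableSpace Ω] {μ : Measure Ω}
    {f : Ω → ℝ} (hf : AEStronglyMeasurable f μ) (h : Integrable (fun ω => f ω ^ 4) μ) :
    MemLp f 4 μ := by
  rw [← integrable_norm_rpow_iff hf (by norm_num) (by norm_num)]
  simpa [← norm_pow] using h.norm

theorem sq_integral_le {Ω : Type*} [MeasurableSpace Ω] {μ : Measure Ω} [IsProbabilityMeasure μ]
    {f : Ω → ℝ} (hf : MemLp f 2 μ) : (∫ ω, f ω ∂μ) ^ 2 ≤ ∫ ω, f ω ^ 2 ∂μ := by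
  have h := variance_eq_sub hf
  have h' := variance_nonneg f μ
  simp only [Pi.pow_apply] at h
  linarith

theorem sq_integral_sq_le {Ω : Type*} [MeasurableSpace Ω] {μ : Measure Ω} [IsProbabilityMeasure μ]
    {f : Ω → ℝ} (hf : MemLp f 4 μ) : (∫ ω, f ω ^ 2 ∂μ) ^ 2 ≤ ∫ ω, f ω ^ 4 ∂μ := by
  have h2 : MemLp (fun ω => f ω ^ 2) 2 μ := by
    refine (memLp_two_iff_integrable_sq (hf.aestronglyMeasurable.pow 2)).2 ?_
    simpa [← pow_mul] using integrable_pow_of_memLp_four hf le_rfl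
  simpa [← pow_mul] using sq_integral_le h2

/-- Every cross term in which f or h appears to the first power factorizes through a zero mean. In
the fourth power only 6 f² h² survives, which is the step of the induction over the summands. -/
theorem integral_pow_four_add_of_indepFun {Ω : Type*} [MeasurableSpace Ω] {μ : Measure Ω}
    [IsProbabilityMeasure μ] {f h : Ω → ℝ} (hind : IndepFun f h μ) (hf : MemLp f 4 μ)
    (hh : MemLp h 4 μ) (hf0 : ∫ ω, f ω ∂μ = 0) (hh0 : ∫ ω, h ω ∂μ = 0) :
    ∫ ω, (f ω + h ω) ^ 2 ∂μ = ∫ ω, f ω ^ 2 ∂μ + ∫ ω, h ω ^ 2 ∂μ ∧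
    ∫ ω, (f ω + h ω) ^ 4 ∂μ = ∫ ω, f ω ^ 4 ∂μ + 6 * (∫ ω, f ω ^ 2 ∂μ) * (∫ ω, h ω ^ 2 ∂μ)
      + ∫ ω, h ω ^ 4 ∂μ := by
  have If : ∀ k : ℕ, k ≤ 4 → Integrable (fun ω => f ω ^ k) μ :=
    fun k hk => integrable_pow_of_memLp_four hf hk
  have Ih : ∀ k : ℕ, k ≤ 4 → Integrable (fun ω => h ω ^ k) μ :=
    fun k hk => integrable_pow_of_memLp_four hh hk
  have ind : ∀ a b : ℕ, IndepFun (fun ω => f ω ^ a) (fun ω => h ω ^ b) μ := fun a b =>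
    hind.comp (φ := fun x : ℝ => x ^ a) (ψ := fun x : ℝ => x ^ b) (by fun_prop) (by fun_prop)
  have I : ∀ a b : ℕ, a ≤ 4 → b ≤ 4 → Integrable (fun ω => f ω ^ a * h ω ^ b) μ :=
    fun a b ha hb => (ind a b).integrable_mul (If a ha) (Ih b hb)
  have E : ∀ a b : ℕ, a ≤ 4 → b ≤ 4 → ∫ ω, f ω ^ a * h ω ^ b ∂μ
      = (∫ ω, f ω ^ a ∂μ) * ∫ ω, h ω ^ b ∂μ := fun a b ha hb =>
    (ind a b).integral_fun_mul_eq_mul_integral (If a ha).aestronglyMeasurable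
      (Ih b hb).aestronglyMeasurable
  constructor
  · have : ∀ ω, (f ω + h ω) ^ 2 = f ω ^ 2 + 2 * (f ω ^ 1 * h ω ^ 1) + h ω ^ 2 := fun ω => by ring
    simp_rw [this]
    rw [integral_add ((If 2 (by norm_num)).fun_add ((I 1 1 (by norm_num) (by norm_num)).const_mul 2))
      (Ih 2 (by norm_num)), integral_add (If 2 (by norm_num))
      ((I 1 1 (by norm_num) (by norm_num)).const_mul 2), integral_const_mul,
      E 1 1 (by norm_num) (by norm_num)]
    simp [hf0]
  · have : ∀ ω, (f ω + h ω) ^ 4 = f ω ^ 4 + 4 * (f ω ^ 3 * h ω ^ 1) + 6 * (f ω ^ 2 * h ω ^ 2)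
        + 4 * (f ω ^ 1 * h ω ^ 3) + h ω ^ 4 := fun ω => by ring
    simp_rw [this]
    have i1 := If 4 le_rfl
    have i2 := (I 3 1 (by norm_num) (by norm_num)).const_mul 4
    have i3 := (I 2 2 (by norm_num) (by norm_num)).const_mul 6
    have i4 := (I 1 3 (by norm_num) (by norm_num)).const_mul 4
    rw [integral_add (((i1.fun_add i2).fun_add i3).fun_add i4) (Ih 4 le_rfl),
      integral_add ((i1.fun_add i2).fun_add i3) i4, integral_add (i1.fun_add i2) i3, integral_add i1 i2,
      integral_const_mul, integral_const_mul, integral_const_mul,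
      E 3 1 (by norm_num) (by norm_num), E 2 2 (by norm_num) (by norm_num),
      E 1 3 (by norm_num) (by norm_num)]
    simp [hf0, hh0, mul_assoc]

/-- Second and fourth moments of a sum of independent centered random variables. -/
theorem moments_sum_le_of_iIndepFun {ι Ω : Type*} [MeasurableSpace Ω] {μ : Measure Ω}
    [IsProbabilityMeasure μ] {ξ : ι → Ω → ℝ} (hind : iIndepFun ξ μ) (hm : ∀ p, Measurable (ξ p))
    (hL : ∀ p, MemLp (ξ p) 4 μ) (h0 : ∀ p, ∫ ω, ξ p ω ∂μ = 0) {q : ι → ℝ} (hq0 : ∀ p, 0 ≤ q p)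
    (hq : ∀ p, ∫ ω, ξ p ω ^ 4 ∂μ ≤ q p ^ 2) (A : Finset ι) :
    MemLp (fun ω => ∑ p ∈ A, ξ p ω) 4 μ ∧ ∫ ω, ∑ p ∈ A, ξ p ω ∂μ = 0 ∧
    ∫ ω, (∑ p ∈ A, ξ p ω) ^ 2 ∂μ = ∑ p ∈ A, ∫ ω, ξ p ω ^ 2 ∂μ ∧
    ∫ ω, (∑ p ∈ A, ξ p ω) ^ 4 ∂μ ≤ 3 * (∑ p ∈ A, q p) ^ 2 := by
  classical
  -- By Jensen, the square root of a bound on the fourth moment also bounds the variance; the single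
  -- family `q` therefore serves both moments.
  have hv : ∀ p, ∫ ω, ξ p ω ^ 2 ∂μ ≤ q p := fun p =>
    abs_le_of_sq_le_sq' ((sq_integral_sq_le (hL p)).trans (hq p)) (hq0 p) |>.2
  have hL1 : ∀ p, Integrable (ξ p) μ := fun p => by
    simpa using integrable_pow_of_memLp_four (hL p) (k := 1) (by norm_num)
  induction A using Finset.induction_on with
  | empty => simp
  | insert a A ha ih =>
    obtain ⟨ih1, ih2, ih3, ih4⟩ := ih
    have hi : IndepFun (fun ω => ∑ p ∈ A, ξ p ω) (ξ a) μ := by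
      have := hind.indepFun_finsetSum_of_notMem hm ha
      have e : (fun ω => ∑ p ∈ A, ξ p ω) = ∑ p ∈ A, ξ p := by ext; simp
      rwa [e]
    obtain ⟨e2, e4⟩ := integral_pow_four_add_of_indepFun hi ih1 (hL a) ih2 (h0 a)
    simp_rw [Finset.sum_insert ha, add_comm (ξ a _)]
    refine ⟨ih1.add (hL a), ?_, ?_, ?_⟩
    · rw [integral_add (integrable_finsetSum _ fun p _ => hL1 p) (hL1 a), ih2, h0, add_zero]
    · rw [e2, ih3, add_comm]
    · rw [e4]
      have hQ : 0 ≤ ∑ p ∈ A, q p := Finset.sum_nonneg fun p _ => hq0 p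
      have h2 : ∫ ω, (∑ p ∈ A, ξ p ω) ^ 2 ∂μ ≤ ∑ p ∈ A, q p := by
        rw [ih3]; exact Finset.sum_le_sum fun p _ => hv p
      -- The induction closes because 3(Q + q)² = 3Q² + 6Qq + 3q² absorbs the cross term 6Qq and the
      -- new fourth moment q².
      have h3 : (∫ ω, (∑ p ∈ A, ξ p ω) ^ 2 ∂μ) * (∫ ω, ξ a ω ^ 2 ∂μ) ≤ (∑ p ∈ A, q p) * q a :=
        mul_le_mul h2 (hv a) (integral_nonneg fun ω => by positivity) hQ
      nlinarith [hq a, hq0 a, sq_nonneg (q a)]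

theorem integral_uniformOn_univ {α : Type*} [Fintype α] [Nonempty α] [MeasurableSpace α]
    [MeasurableSingletonClass α] (f : α → ℝ) :
    ∫ a, f a ∂(uniformOn (Set.univ : Set α)) = (∑ a, f a) / Fintype.card α := by
  rw [integral_fintype (Integrable.of_finite ..), Finset.sum_div]
  refine Finset.sum_congr rfl fun a _ => ?_
  rw [Measure.real, uniformOn_univ]
  simp [div_eq_inv_mul]

/-! ### Resampling with replacement as a product measure -/

section Draws

variable {m : ℕ} {n s : Fin m → ℕ}

/-- The law of the index tuple drawn in one resample, as a product measure. -/
noncomputable def drawLaw (n s : Fin m → ℕ) : Measure (ResampleIndex n s) :=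
  Measure.pi fun i => Measure.pi fun _ : Fin (s i) => uniformOn (Set.univ : Set (Fin (n i)))

instance [∀ i, NeZero (n i)] : IsProbabilityMeasure (drawLaw n s) := by
  unfold drawLaw; infer_instance

/-- Turns the finite average over index tuples into an integral, so that independence of the draws
and L^p inequalities can be used. -/
theorem starMean_eq_integral [∀ i, NeZero (n i)] (f : ResampleIndex n s → ℝ) :
    starMean f = ∫ J, f J ∂(drawLaw n s) := by
  rw [integral_fintype (Integrable.of_finite ..), starMean, Finset.sum_div]
  refine Finset.sum_congr rfl fun J _ => ?_
  have : (drawLaw n s).real {J} = (Fintype.card (ResampleIndex n s) : ℝ)⁻¹ := by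
    rw [Measure.real, drawLaw, Measure.pi_singleton]
    simp_rw [Measure.pi_singleton, uniformOn_univ]
    simp [ENNReal.toReal_prod]
  rw [this, smul_eq_mul, div_eq_inv_mul]

theorem measurePreserving_draw [∀ i, NeZero (n i)] (i : Fin m) (l : Fin (s i)) :
    MeasurePreserving (fun J : ResampleIndex n s => J i l) (drawLaw n s)
      (uniformOn (Set.univ : Set (Fin (n i)))) :=
  (measurePreserving_eval (fun _ : Fin (s i) => uniformOn (Set.univ : Set (Fin (n i)))) l).comp
    (measurePreserving_eval
      (fun i => Measure.pi fun _ : Fin (s i) => uniformOn (Set.univ : Set (Fin (n i)))) i)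

theorem integral_draw [∀ i, NeZero (n i)] (i : Fin m) (l : Fin (s i)) (φ : Fin (n i) → ℝ) :
    ∫ J, φ (J i l) ∂(drawLaw n s) = (∑ j, φ j) / n i := by
  have h := (measurePreserving_draw (n := n) (s := s) i l).map_eq
  rw [← integral_map (f := φ) (measurePreserving_draw (n := n) (s := s) i l).measurable.aemeasurable
    (by fun_prop), h, integral_uniformOn_univ]
  simp

theorem iIndepFun_draw [∀ i, NeZero (n i)] (h : ∀ i, Fin (n i) → ℝ) :
    iIndepFun (fun (p : (i : Fin m) × Fin (s i)) (J : ResampleIndex n s) => h p.1 (J p.1 p.2))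
      (drawLaw n s) := by
  have := Measure.infinitePi_eq_pi
    (μ := fun i => Measure.pi fun _ : Fin (s i) => uniformOn (Set.univ : Set (Fin (n i))))
  rw [drawLaw, ← this]
  simp_rw [← Measure.infinitePi_eq_pi]
  exact iIndepFun_uncurry_infinitePi (X := fun i (_ : Fin (s i)) => h i)
    (fun i (_ : Fin (s i)) => uniformOn (Set.univ : Set (Fin (n i)))) (by fun_prop)

/-- The first, second and fourth moments, under resampling, of a centered linear statistic. -/
theorem starMean_linear [∀ i, NeZero (n i)] (hs : ∀ i, 0 < s i) (h : ∀ i, Fin (n i) → ℝ)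
    (h0 : ∀ i, ∑ j, h i j = 0) :
    starMean (fun J : ResampleIndex n s => ∑ i, (∑ l, h i (J i l)) / s i) = 0 ∧
    starMean (fun J : ResampleIndex n s => (∑ i, (∑ l, h i (J i l)) / s i) ^ 2)
      = ∑ i, ((∑ j, h i j ^ 2) / n i) / s i ∧
    starMean (fun J : ResampleIndex n s => (∑ i, (∑ l, h i (J i l)) / s i) ^ 4)
      ≤ 3 * (∑ i, √((∑ j, h i j ^ 4) / n i) / s i) ^ 2 := by
  have e : ∀ J : ResampleIndex n s, ∑ i, (∑ l, h i (J i l)) / s i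
      = ∑ p : (i : Fin m) × Fin (s i), h p.1 (J p.1 p.2) / s p.1 := fun J => by
    rw [Fintype.sum_sigma]; simp_rw [Finset.sum_div]
  have hs' : ∀ i, (s i : ℝ) ≠ 0 := fun i => by exact_mod_cast (hs i).ne'
  have M := moments_sum_le_of_iIndepFun (μ := drawLaw n s)
    (ξ := fun (p : (i : Fin m) × Fin (s i)) J => h p.1 (J p.1 p.2) / s p.1)
    -- The root of the fourth moment of one summand h/s_i; adding it over the s_i draws of input i
    -- leaves a single factor 1/s_i.
    (q := fun p => √((∑ j, h p.1 j ^ 4) / n p.1) / s p.1 ^ 2)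
    (iIndepFun_draw fun i j => h i j / s i) (fun p => by fun_prop)
    (fun p => MemLp.of_discrete)
    (fun p => by
      rw [integral_draw p.1 p.2 (fun j => h p.1 j / s p.1), ← Finset.sum_div, h0]; simp)
    (fun p => by positivity)
    (fun p => by
      rw [integral_draw p.1 p.2 (fun j => (h p.1 j / s p.1) ^ 4), div_pow, Real.sq_sqrt
        (by positivity)]
      simp_rw [div_pow]
      rw [← Finset.sum_div, ← pow_mul, div_right_comm])
    Finset.univ
  simp_rw [e, starMean_eq_integral]
  refine ⟨M.2.1, M.2.2.1.trans ?_, M.2.2.2.trans_eq ?_⟩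
  · rw [Fintype.sum_sigma]
    refine Finset.sum_congr rfl fun i _ => ?_
    rw [Finset.sum_congr rfl fun l _ => integral_draw i l (fun j => (h i j / s i) ^ 2)]
    simp_rw [div_pow]
    rw [Finset.sum_const, ← Finset.sum_div, Finset.card_univ, Fintype.card_fin, nsmul_eq_mul]
    field_simp [hs' i]
  · congr 2
    rw [Fintype.sum_sigma]
    refine Finset.sum_congr rfl fun i _ => ?_
    refine (Finset.sum_const (√((∑ j, h i j ^ 4) / n i) / (s i : ℝ) ^ 2)).trans ?_
    rw [Finset.card_univ, Fintype.card_fin, nsmul_eq_mul]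
    field_simp [hs' i]

end Draws

/-! ### Perturbation of a variance -/

theorem abs_covariance_le {Ω : Type*} [MeasurableSpace Ω] {μ : Measure Ω}
    [IsProbabilityMeasure μ] {f h : Ω → ℝ} (hf : MemLp f 2 μ) (hh : MemLp h 2 μ) :
    |cov[f, h; μ]| ≤ √(variance f μ) * √(variance h μ) := by
  rw [← Real.sqrt_mul (variance_nonneg _ _)]
  refine Real.abs_le_sqrt ?_
  -- Cauchy–Schwarz by the discriminant: the variance of t f + h is a nonnegative quadratic in t.
  have key : ∀ t : ℝ, 0 ≤ variance f μ * (t * t) + 2 * cov[f, h; μ] * t + variance h μ := by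
    intro t
    have h1 := variance_add (hf.const_smul t) hh
    rw [variance_smul, covariance_smul_left] at h1
    have := variance_nonneg (t • f + h) μ
    rw [h1] at this
    nlinarith
  have := discrim_le_zero key
  rw [discrim] at this
  nlinarith

/-- Perturbing a square integrable random variable changes its variance by little. -/
theorem abs_variance_add_sub_le {Ω : Type*} [MeasurableSpace Ω] {μ : Measure Ω}
    [IsProbabilityMeasure μ] {L e : Ω → ℝ} (hL : MemLp L 2 μ) (he : MemLp e 2 μ) :
    |variance (fun ω => L ω + e ω) μ - variance L μ|
      ≤ 2 * √(variance L μ) * √(∫ ω, e ω ^ 2 ∂μ) + ∫ ω, e ω ^ 2 ∂μ := by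
  have h1 : variance (fun ω => L ω + e ω) μ = variance L μ + 2 * cov[L, e; μ] + variance e μ :=
    variance_add hL he
  have h2 : variance e μ ≤ ∫ ω, e ω ^ 2 ∂μ := variance_le_expectation_sq he.aestronglyMeasurable
  have h3 : |cov[L, e; μ]| ≤ √(variance L μ) * √(variance e μ) :=
    abs_covariance_le hL he
  have h4 : √(variance e μ) ≤ √(∫ ω, e ω ^ 2 ∂μ) := Real.sqrt_le_sqrt h2
  have h5 := mul_le_mul_of_nonneg_left h4 (Real.sqrt_nonneg (variance L μ))
  have h6 := variance_nonneg e μ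
  rw [h1, abs_le]
  rw [abs_le] at h3
  constructor <;> nlinarith

/-! ### Chebyshev bound for the sample variance of i.i.d. groups -/

section Pi

variable {T : Type*} [MeasurableSpace T] {ρ : Measure T} [IsProbabilityMeasure ρ] {B : ℕ}

theorem measurePreserving_eval_pi (b : Fin B) :
    MeasurePreserving (fun y : Fin B → T => y b) (Measure.pi fun _ => ρ) ρ :=
  measurePreserving_eval (fun _ : Fin B => ρ) b

theorem integral_eval_pi {f : T → ℝ} (hf : AEStronglyMeasurable f ρ) (b : Fin B) :
    ∫ y : Fin B → T, f (y b) ∂(Measure.pi fun _ => ρ) = ∫ t, f t ∂ρ := by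
  have h := measurePreserving_eval_pi (ρ := ρ) b
  conv_rhs => rw [← h.map_eq]
  rw [integral_map h.measurable.aemeasurable (by rwa [h.map_eq])]

theorem memLp_sum_eval_pi {f : T → ℝ} {p : ℝ≥0∞} (hf : MemLp f p ρ) :
    MemLp (fun y : Fin B → T => ∑ b, f (y b)) p (Measure.pi fun _ => ρ) :=
  memLp_finsetSum _ fun b _ => hf.comp_measurePreserving (measurePreserving_eval_pi b)

theorem integral_sum_pi {f : T → ℝ} (hf : Integrable f ρ) :
    ∫ y : Fin B → T, ∑ b, f (y b) ∂(Measure.pi fun _ => ρ) = B * ∫ t, f t ∂ρ := by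
  rw [integral_finsetSum]
  · simp [integral_eval_pi hf.aestronglyMeasurable]
  · exact fun b _ => (measurePreserving_eval_pi b).integrable_comp_of_integrable hf

theorem integral_sq_sum_pi {f : T → ℝ} (hf : MemLp f 2 ρ) (h0 : ∫ t, f t ∂ρ = 0) :
    ∫ y : Fin B → T, (∑ b, f (y b)) ^ 2 ∂(Measure.pi fun _ => ρ) = B * ∫ t, f t ^ 2 ∂ρ := by
  have h := variance_sum_pi (ι := Fin B) (μ := fun _ => ρ) (X := fun _ => f) fun _ => hf
  have e : (∑ b : Fin B, fun y : Fin B → T => f (y b)) = fun y : Fin B → T => ∑ b, f (y b) := by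
    ext; simp
  rw [e, variance_of_integral_eq_zero, Finset.sum_const, Finset.card_univ, Fintype.card_fin,
    nsmul_eq_mul, variance_of_integral_eq_zero hf.aemeasurable h0] at h
  · exact h
  · exact (memLp_sum_eval_pi hf).aemeasurable
  · rw [integral_sum_pi (hf.integrable (by norm_num)), h0, mul_zero]

/-- Concentration of the difference of the between-group variance of `Z` and the mean of `U` for
i.i.d. groups. -/
theorem pi_sampleVar_concentration (hB : 2 ≤ B) {Z U : T → ℝ} (hZ : MemLp Z 4 ρ)
    (hU : MemLp U 2 ρ) {σ2 : ℝ}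
    (hσ : ∫ t, ((Z t - ∫ t, Z t ∂ρ) ^ 2 - U t) ∂ρ = σ2) {s δ : ℝ} (hs : 0 < s) (hδ : 0 < δ) :
    (Measure.pi fun _ : Fin B => ρ).real {y | δ ≤ s * |(∑ b, (Z (y b) - (∑ b, Z (y b)) / B) ^ 2)
        / ((B : ℝ) - 1) - (∑ b, U (y b)) / B - σ2|}
      ≤ (8 / δ + 8 / δ ^ 2) * (1 + s ^ 2 * ∫ t, (Z t - ∫ t, Z t ∂ρ) ^ 4 ∂ρ
        + s ^ 2 * ∫ t, U t ^ 2 ∂ρ) / B := by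
  set c := ∫ t, Z t ∂ρ with hc
  set w := ∫ t, (Z t - c) ^ 4 ∂ρ with hw
  set u := ∫ t, U t ^ 2 ∂ρ with hu
  set v := ∫ t, (Z t - c) ^ 2 ∂ρ with hv
  have hB1 : (1 : ℝ) ≤ (B : ℝ) - 1 := by
    have : (2 : ℝ) ≤ B := by exact_mod_cast hB
    linarith
  have hB0 : (0 : ℝ) < B := by linarith
  have hZc : MemLp (fun t => Z t - c) 4 ρ := hZ.sub (memLp_const c)
  have hZc2 : MemLp (fun t => Z t - c) 2 ρ := hZc.mono_exponent (by norm_num)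
  have hZ1 : Integrable Z ρ := hZ.integrable (by norm_num)
  have hZc0 : ∫ t, (Z t - c) ∂ρ = 0 := by
    rw [integral_sub hZ1 (integrable_const c)]; simp [hc]
  have hsq : MemLp (fun t => (Z t - c) ^ 2) 2 ρ := by
    refine (memLp_two_iff_integrable_sq (hZc.aestronglyMeasurable.pow 2)).2 ?_
    simpa [← pow_mul] using integrable_pow_of_memLp_four hZc le_rfl
  have hv0 : 0 ≤ v := integral_nonneg fun t => by positivity
  have hw0 : 0 ≤ w := integral_nonneg fun t => by positivity
  have hu0 : 0 ≤ u := integral_nonneg fun t => by positivity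
  have hvw : v ^ 2 ≤ w := sq_integral_sq_le hZc
  have hHU : MemLp (fun t => (Z t - c) ^ 2 - U t) 2 ρ := hsq.sub hU
  -- One centred variable carries both the squared deviation about the true mean and the noise
  -- correction, so the main term is an i.i.d. average of H.
  set H : T → ℝ := fun t => (Z t - c) ^ 2 - U t - σ2 with hH
  have hHL : MemLp H 2 ρ := hHU.sub (memLp_const σ2)
  have hH0 : ∫ t, H t ∂ρ = 0 := by
    simp only [hH]
    rw [integral_sub (hHU.integrable (by norm_num)) (integrable_const σ2)]
    rw [hσ]; simp
  have hH2 : ∫ t, H t ^ 2 ∂ρ ≤ 2 * w + 2 * u := by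
    have h1 : ∫ t, H t ^ 2 ∂ρ = variance (fun t => (Z t - c) ^ 2 - U t) ρ := by
      rw [variance_eq_integral hHU.aemeasurable]
      simp only [hσ, hH]
    have h2 : variance (fun t => (Z t - c) ^ 2 - U t) ρ ≤ ∫ t, ((Z t - c) ^ 2 - U t) ^ 2 ∂ρ :=
      variance_le_expectation_sq hHU.aestronglyMeasurable
    rw [h1, hw, hu, ← integral_const_mul, ← integral_const_mul, ← integral_add]
    · refine h2.trans (integral_mono hHU.integrable_sq ?_ fun t => ?_)
      · exact ((integrable_pow_of_memLp_four hZc le_rfl).const_mul 2).add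
          (hU.integrable_sq.const_mul 2)
      · simp only
        nlinarith [sq_nonneg ((Z t - c) ^ 2 + U t)]
    · exact (integrable_pow_of_memLp_four hZc le_rfl).const_mul 2
    · exact hU.integrable_sq.const_mul 2
  set π := Measure.pi fun _ : Fin B => ρ with hπ
  set A : (Fin B → T) → ℝ := fun y => (∑ b, H (y b)) / B
  -- Dominates the error made by centring at the sample mean with divisor B − 1 instead of at c with
  -- divisor B. Its mean is 2v/(B − 1), at most 4v/B because B ≥ 2.
  set Q : (Fin B → T) → ℝ := fun y =>
    (∑ b, (Z (y b) - c) ^ 2 + (∑ b, (Z (y b) - c)) ^ 2) / (B * (B - 1))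
  have hA2 : ∫ y, (s * A y) ^ 2 ∂π ≤ s ^ 2 * (2 * w + 2 * u) / B := by
    have : ∀ y, (s * A y) ^ 2 = s ^ 2 / B ^ 2 * (∑ b, H (y b)) ^ 2 := fun y => by
      simp only [A]; field_simp
    simp_rw [this]
    rw [integral_const_mul, integral_sq_sum_pi hHL hH0]
    have : s ^ 2 / (B : ℝ) ^ 2 * (B * ∫ t, H t ^ 2 ∂ρ) = s ^ 2 / B * ∫ t, H t ^ 2 ∂ρ := by
      field_simp
    rw [this, mul_div_right_comm]
    gcongr
  have hiA : Integrable (fun y => (s * A y) ^ 2) π := by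
    have : MemLp (fun y : Fin B → T => s * A y) 2 π := by
      have := ((memLp_sum_eval_pi (B := B) hHL).const_mul (B : ℝ)⁻¹).const_mul s
      simpa [A, div_eq_inv_mul] using this
    exact this.integrable_sq
  have i1 : Integrable (fun y : Fin B → T => ∑ b, (Z (y b) - c) ^ 2) π :=
    (memLp_sum_eval_pi hsq).integrable (by norm_num)
  have i2 : Integrable (fun y : Fin B → T => (∑ b, (Z (y b) - c)) ^ 2) π :=
    (memLp_sum_eval_pi hZc2).integrable_sq
  have hiQ : Integrable (fun y => s * Q y) π := ((i1.fun_add i2).div_const _).const_mul s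
  have hQ : ∫ y, s * Q y ∂π ≤ s * (4 * v / B) := by
    rw [integral_const_mul]
    refine mul_le_mul_of_nonneg_left ?_ hs.le
    simp only [Q]
    rw [integral_div, integral_add i1 i2, integral_sq_sum_pi hZc2 hZc0,
      integral_sum_pi (hsq.integrable (by norm_num)), div_le_div_iff₀ (by nlinarith) hB0]
    change (B * v + B * v) * B ≤ 4 * v * (B * (B - 1))
    nlinarith [mul_nonneg (mul_nonneg hv0 hB0.le) (by linarith : (0 : ℝ) ≤ B - 2)]
  have hQ0 : ∀ y, 0 ≤ s * Q y := fun y => by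
    have : (0 : ℝ) ≤ B - 1 := by linarith
    simp only [Q]; positivity
  have hsub : {y : Fin B → T | δ ≤ s * |(∑ b, (Z (y b) - (∑ b, Z (y b)) / B) ^ 2)
        / ((B : ℝ) - 1) - (∑ b, U (y b)) / B - σ2|}
      ⊆ {y | (δ / 2) ^ 2 ≤ (s * A y) ^ 2} ∪ {y | δ / 2 ≤ s * Q y} := by
    intro y hy
    have hD : (∑ b, (Z (y b) - (∑ b, Z (y b)) / B) ^ 2)
        = ∑ b, (Z (y b) - c) ^ 2 - (∑ b, (Z (y b) - c)) ^ 2 / B := by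
      set a := (∑ b, Z (y b)) / B with ha
      have e1 : ∑ b, Z (y b) = B * a := by rw [ha]; field_simp
      have e2 : ∑ b, (Z (y b) - c) = B * (a - c) := by
        rw [Finset.sum_sub_distrib, e1]; simp; ring
      have e3 : ∀ b, (Z (y b) - a) ^ 2
          = (Z (y b) - c) ^ 2 - 2 * (a - c) * (Z (y b) - c) + (a - c) ^ 2 := fun b => by ring
      simp_rw [e3]
      rw [Finset.sum_add_distrib, Finset.sum_sub_distrib, ← Finset.mul_sum, e2]
      simp
      field_simp
      ring
    have hA : A y = (∑ b, (Z (y b) - c) ^ 2) / B - (∑ b, U (y b)) / B - σ2 := by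
      simp only [A, H]
      rw [Finset.sum_sub_distrib, Finset.sum_sub_distrib]
      simp
      field_simp
    have h1 : 0 ≤ ∑ b, (Z (y b) - c) ^ 2 := by positivity
    have h2 : (∑ b, (Z (y b) - (∑ b, Z (y b)) / B) ^ 2) / ((B : ℝ) - 1) - (∑ b, U (y b)) / B - σ2
        = A y + (∑ b, (Z (y b) - c) ^ 2 - (∑ b, (Z (y b) - c)) ^ 2) / (B * (B - 1)) := by
      rw [hD, hA]
      have : (B : ℝ) - 1 ≠ 0 := by linarith
      field_simp
      ring
    have h3 : |(∑ b, (Z (y b) - c) ^ 2 - (∑ b, (Z (y b) - c)) ^ 2) / (B * (B - 1) : ℝ)| ≤ Q y := by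
      have hBB : (0 : ℝ) < B * (B - 1) := by nlinarith
      rw [abs_div, abs_of_pos hBB]
      simp only [Q]
      gcongr
      rw [abs_le]
      constructor <;> nlinarith [sq_nonneg (∑ b, (Z (y b) - c))]
    simp only [Set.mem_ofPred_eq, h2] at hy
    have h4 := hy.trans (mul_le_mul_of_nonneg_left ((abs_add_le _ _).trans
      (add_le_add_right h3 _)) hs.le)
    rw [Set.mem_union, Set.mem_ofPred_eq, Set.mem_ofPred_eq]
    by_contra! hcon
    have h5 : |s * A y| < δ / 2 := abs_lt_of_sq_lt_sq hcon.1 (by linarith)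
    rw [abs_mul, abs_of_pos hs] at h5
    linarith [hcon.2]
  have m1 := mul_meas_ge_le_integral_of_nonneg (ae_of_all π fun y => sq_nonneg (s * A y)) hiA
    ((δ / 2) ^ 2)
  have m2 := mul_meas_ge_le_integral_of_nonneg (ae_of_all π hQ0) hiQ (δ / 2)
  have m3 := (measureReal_mono (μ := π) hsub).trans (measureReal_union_le _ _)
  refine m3.trans ?_
  -- Markov's inequality for Q yields s v, of first order; x ≤ 1 + x² and v² ≤ w convert it to the
  -- fourth moment. This is the origin of the 1 in the bound.
  have hsv : s * v ≤ 1 + s ^ 2 * w := by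
    nlinarith [sq_nonneg (s * v - 1), mul_le_mul_of_nonneg_left hvw (sq_nonneg s)]
  have hsu : 0 ≤ s ^ 2 * u := by positivity
  have b1 : π.real {y | (δ / 2) ^ 2 ≤ (s * A y) ^ 2} ≤ 8 / δ ^ 2 * (1 + s ^ 2 * w + s ^ 2 * u) / B := by
    have := m1.trans hA2
    rw [← le_div_iff₀' (by positivity)] at this
    refine this.trans ?_
    rw [div_div, div_mul_eq_mul_div, div_div, div_le_div_iff₀ (by positivity) (by positivity)]
    have : s ^ 2 * (2 * w + 2 * u) * (δ ^ 2 * B) ≤ 2 * (1 + s ^ 2 * w + s ^ 2 * u) * (δ ^ 2 * B) :=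
      mul_le_mul_of_nonneg_right (by linarith) (by positivity)
    linarith
  have b2 : π.real {y | δ / 2 ≤ s * Q y} ≤ 8 / δ * (1 + s ^ 2 * w + s ^ 2 * u) / B := by
    have := m2.trans hQ
    rw [← le_div_iff₀' (by positivity)] at this
    refine this.trans ?_
    have e : s * (4 * v / B) / (δ / 2) = 8 / δ * (s * v) / B := by field_simp; ring
    rw [e]
    gcongr
    linarith
  have e : (8 / δ + 8 / δ ^ 2) * (1 + s ^ 2 * w + s ^ 2 * u) / B
      = 8 / δ ^ 2 * (1 + s ^ 2 * w + s ^ 2 * u) / B + 8 / δ * (1 + s ^ 2 * w + s ^ 2 * u) / B := by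
    ring
  rw [e]
  exact add_le_add b1 b2

end Pi

/-! ### Replications within one group -/

section Within

variable {R : ℕ}

/-- The mean of the replications in one group. -/
noncomputable def repMean (t : Fin R → ℝ) : ℝ := (∑ r, t r) / (R : ℝ)

/-- The unbiased estimate of the simulation variance of `repMean`. -/
noncomputable def repVar (t : Fin R → ℝ) : ℝ :=
  (∑ r, (t r - repMean t) ^ 2) / ((R : ℝ) * ((R : ℝ) - 1))

theorem measurable_repMean : Measurable (repMean : (Fin R → ℝ) → ℝ) := by
  unfold repMean; fun_prop

theorem measurable_repVar : Measurable (repVar : (Fin R → ℝ) → ℝ) := by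
  have := measurable_repMean (R := R)
  unfold repVar; fun_prop

theorem svbEstimator_eq {B : ℕ} (θ : ℝ) (y : Fin B → Fin R → ℝ) :
    svbEstimator θ y = θ * ((∑ b, (repMean (y b) - (∑ b, repMean (y b)) / B) ^ 2) / ((B : ℝ) - 1)
      - (∑ b, repVar (y b)) / B) := by
  simp only [svbEstimator, withinVar, repVar, groupMean, grandMean, repMean]
  rw [← Finset.sum_div]
  congr 2
  rw [← Finset.sum_div, div_div, div_div]
  congr 1
  ring

/-- The parallel axis identity: it replaces the random centre by any fixed point a, in particular by
the true mean. -/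
theorem sum_sub_repMean_sq (hR : 2 ≤ R) (t : Fin R → ℝ) (a : ℝ) :
    ∑ r, (t r - repMean t) ^ 2 = ∑ r, (t r - a) ^ 2 - R * (repMean t - a) ^ 2 := by
  have hR0 : (R : ℝ) ≠ 0 := by positivity
  have e1 : ∑ r, t r = R * repMean t := by rw [repMean]; field_simp
  have e3 : ∀ r, (t r - repMean t) ^ 2
      = (t r - a) ^ 2 - 2 * (repMean t - a) * (t r - a) + (repMean t - a) ^ 2 := fun r => by ring
  simp_rw [e3]
  rw [Finset.sum_add_distrib, Finset.sum_sub_distrib, ← Finset.mul_sum, Finset.sum_sub_distrib, e1]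
  simp
  ring

theorem repVar_nonneg (hR : 2 ≤ R) (t : Fin R → ℝ) : 0 ≤ repVar t := by
  have : (0 : ℝ) ≤ (R : ℝ) - 1 := by
    have : (2 : ℝ) ≤ R := by exact_mod_cast hR
    linarith
  unfold repVar; positivity

/-- Centring at the sample mean minimizes the sum of squares, and R(R − 1) ≥ R²/2 since R ≥ 2, so
the estimate is at most 2/R² times the sum of squares about a. Cauchy–Schwarz over the R terms then
gives 4/R³. -/
theorem repVar_sq_le (hR : 2 ≤ R) (t : Fin R → ℝ) (a : ℝ) :
    repVar t ^ 2 ≤ 4 / (R : ℝ) ^ 3 * ∑ r, (t r - a) ^ 4 := by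
  have hR2 : (2 : ℝ) ≤ R := by exact_mod_cast hR
  have hR0 : (0 : ℝ) < R := by linarith
  have h1 : repVar t ≤ 2 / (R : ℝ) ^ 2 * ∑ r, (t r - a) ^ 2 := by
    have hnn : 0 ≤ ∑ r, (t r - a) ^ 2 := by positivity
    rw [repVar, sum_sub_repMean_sq hR t a, div_mul_eq_mul_div,
      div_le_div_iff₀ (by nlinarith) (by positivity)]
    calc (∑ r, (t r - a) ^ 2 - R * (repMean t - a) ^ 2) * (R : ℝ) ^ 2
        ≤ (∑ r, (t r - a) ^ 2) * (R : ℝ) ^ 2 := by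
          gcongr
          have : 0 ≤ R * (repMean t - a) ^ 2 := by positivity
          linarith
      _ ≤ (∑ r, (t r - a) ^ 2) * (2 * (R * (R - 1))) := by
          gcongr
          nlinarith
      _ = _ := by ring
  have h2 : (∑ r, (t r - a) ^ 2) ^ 2 ≤ R * ∑ r, (t r - a) ^ 4 := by
    have := sq_sum_le_card_mul_sum_sq (s := Finset.univ) (f := fun r => (t r - a) ^ 2)
    simpa [← pow_mul] using this
  calc repVar t ^ 2 ≤ (2 / (R : ℝ) ^ 2 * ∑ r, (t r - a) ^ 2) ^ 2 :=
        pow_le_pow_left₀ (repVar_nonneg hR t) h1 2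
    _ = 4 / (R : ℝ) ^ 4 * (∑ r, (t r - a) ^ 2) ^ 2 := by ring
    _ ≤ 4 / (R : ℝ) ^ 4 * (R * ∑ r, (t r - a) ^ 4) := by gcongr
    _ = _ := by field_simp

variable {ν : Measure ℝ} [IsProbabilityMeasure ν]

theorem memLp_repMean (hν : MemLp (fun y : ℝ => y) 4 ν) :
    MemLp (repMean : (Fin R → ℝ) → ℝ) 4 (Measure.pi fun _ => ν) := by
  have e : (repMean : (Fin R → ℝ) → ℝ) = fun t => (R : ℝ)⁻¹ * ∑ r, t r := by
    ext t; rw [repMean, div_eq_inv_mul]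
  rw [e]
  exact (memLp_sum_eval_pi (B := R) hν).const_mul (R : ℝ)⁻¹

theorem memLp_repVar (hR : 2 ≤ R) (hν : MemLp (fun y : ℝ => y) 4 ν) :
    MemLp (repVar : (Fin R → ℝ) → ℝ) 2 (Measure.pi fun _ => ν) := by
  refine (memLp_two_iff_integrable_sq measurable_repVar.aestronglyMeasurable).2 ?_
  have h4 : MemLp (fun t : ℝ => (t - 0) ^ 4) 1 ν := by
    rw [memLp_one_iff_integrable]; simpa using integrable_pow_of_memLp_four hν le_rfl
  refine (((memLp_sum_eval_pi (B := R) h4).integrable (le_refl 1)).const_mul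
    (4 / (R : ℝ) ^ 3)).mono' (measurable_repVar.pow_const 2).aestronglyMeasurable
    (ae_of_all _ fun t => ?_)
  rw [Real.norm_of_nonneg (by positivity)]
  exact repVar_sq_le hR t 0

/-- The second identity is the reason for the correction V/R: `repVar` estimates the noise variance
of a group mean without bias. Both fourth order quantities are of order μ₄/R², whence the factor B
R² in the hypotheses. -/
theorem repMean_moments (hR : 2 ≤ R) (hν : MemLp (fun y : ℝ => y) 4 ν) {a : ℝ}
    (ha : ∫ y, y ∂ν = a) :
    ∫ t : Fin R → ℝ, (repMean t - a) ∂(Measure.pi fun _ => ν) = 0 ∧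
    ∫ t : Fin R → ℝ, (repMean t - a) ^ 2 ∂(Measure.pi fun _ => ν)
      = ∫ t : Fin R → ℝ, repVar t ∂(Measure.pi fun _ => ν) ∧
    ∫ t : Fin R → ℝ, (repMean t - a) ^ 4 ∂(Measure.pi fun _ => ν)
      ≤ 3 * (∫ y, (y - a) ^ 4 ∂ν) / (R : ℝ) ^ 2 ∧
    ∫ t : Fin R → ℝ, repVar t ^ 2 ∂(Measure.pi fun _ => ν)
      ≤ 4 * (∫ y, (y - a) ^ 4 ∂ν) / (R : ℝ) ^ 2 := by
  have hR2 : (2 : ℝ) ≤ R := by exact_mod_cast hR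
  have hR0 : (R : ℝ) ≠ 0 := by linarith
  have hc : MemLp (fun y : ℝ => y - a) 4 ν := hν.sub (memLp_const a)
  have hc0 : ∫ y, (y - a) ∂ν = 0 := by
    rw [integral_sub (hν.integrable (by norm_num)) (integrable_const a), ha]; simp
  have hμ4 : 0 ≤ ∫ y, (y - a) ^ 4 ∂ν := integral_nonneg fun y => by positivity
  have e : ∀ t : Fin R → ℝ, repMean t - a = ∑ r, (t r - a) / R := fun t => by
    rw [← Finset.sum_div, Finset.sum_sub_distrib, repMean]; simp; field_simp
  have hcd : MemLp (fun y : ℝ => (y - a) / R) 4 ν := by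
    simpa [div_eq_inv_mul] using hc.const_mul (R : ℝ)⁻¹
  have M := moments_sum_le_of_iIndepFun (μ := Measure.pi fun _ : Fin R => ν)
    (ξ := fun r t => (t r - a) / R) (q := fun _ => √(∫ y, (y - a) ^ 4 ∂ν) / R ^ 2)
    (iIndepFun_pi (X := fun _ y => (y - a) / R) fun _ => by fun_prop) (fun r => by fun_prop)
    (fun r => hcd.comp_measurePreserving (measurePreserving_eval_pi r))
    (fun r => by
      rw [integral_eval_pi (f := fun y => (y - a) / R) hcd.aestronglyMeasurable, integral_div, hc0,
        zero_div])
    (fun r => by positivity)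
    (fun r => by
      rw [integral_eval_pi (f := fun y => ((y - a) / R) ^ 4) (hcd.aestronglyMeasurable.pow 4),
        div_pow, Real.sq_sqrt hμ4]
      simp_rw [div_pow]
      rw [integral_div, ← pow_mul])
    Finset.univ
  have i2 : Integrable (fun t : Fin R → ℝ => ∑ r, (t r - a) ^ 2) (Measure.pi fun _ => ν) :=
    (memLp_sum_eval_pi (memLp_one_iff_integrable.2
      (integrable_pow_of_memLp_four hc (k := 2) (by norm_num)))).integrable (le_refl 1)
  have i4 : Integrable (fun t : Fin R → ℝ => ∑ r, (t r - a) ^ 4) (Measure.pi fun _ => ν) :=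
    (memLp_sum_eval_pi (memLp_one_iff_integrable.2
      (integrable_pow_of_memLp_four hc (k := 4) (by norm_num)))).integrable (le_refl 1)
  have s2 : ∫ t : Fin R → ℝ, (repMean t - a) ^ 2 ∂(Measure.pi fun _ => ν)
      = (∫ y, (y - a) ^ 2 ∂ν) / R := by
    simp_rw [e]
    rw [M.2.2.1, Finset.sum_congr rfl fun r _ => integral_eval_pi (ρ := ν)
      (f := fun y => ((y - a) / R) ^ 2) (hcd.aestronglyMeasurable.pow 2) r]
    simp_rw [div_pow]
    rw [integral_div]
    simp
    field_simp
  refine ⟨?_, ?_, ?_, ?_⟩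
  · simp_rw [e]; exact M.2.1
  · have i3 : Integrable (fun t : Fin R → ℝ => R * (repMean t - a) ^ 2) (Measure.pi fun _ => ν) :=
      (integrable_pow_of_memLp_four ((memLp_repMean hν).sub (memLp_const a)) (k := 2)
        (by norm_num)).const_mul _
    simp only [repVar]
    -- With m₂ the variance of one replication, the two sums have means R m₂ and m₂; their
    -- difference (R − 1) m₂ cancels the divisor R − 1.
    simp_rw [sum_sub_repMean_sq hR _ a]
    rw [integral_div, integral_sub i2 i3, integral_const_mul, s2,
      integral_sum_pi (f := fun y => (y - a) ^ 2)
        (integrable_pow_of_memLp_four hc (k := 2) (by norm_num))]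
    have : (R : ℝ) - 1 ≠ 0 := by linarith
    field_simp
  · simp_rw [e]
    refine M.2.2.2.trans_eq ?_
    rw [Finset.sum_const, Finset.card_univ, Fintype.card_fin, nsmul_eq_mul, mul_pow, div_pow,
      Real.sq_sqrt hμ4]
    field_simp
  · refine (integral_mono (memLp_repVar hR hν).integrable_sq (i4.const_mul (4 / (R : ℝ) ^ 3))
      fun t => repVar_sq_le hR t a).trans_eq ?_
    rw [integral_const_mul, integral_sum_pi (f := fun y => (y - a) ^ 4)
      (integrable_pow_of_memLp_four hc (k := 4) (by norm_num))]
    field_simp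

end Within

/-! ### Law of one group: a uniform mixture over the resamples -/

theorem add_pow_four_le (x y : ℝ) : (x + y) ^ 4 ≤ 8 * (x ^ 4 + y ^ 4) := by
  have h1 : (x + y) ^ 2 ≤ 2 * (x ^ 2 + y ^ 2) := by nlinarith [sq_nonneg (x - y)]
  have h2 : ((x + y) ^ 2) ^ 2 ≤ (2 * (x ^ 2 + y ^ 2)) ^ 2 :=
    pow_le_pow_left₀ (by positivity) h1 2
  nlinarith [sq_nonneg (x ^ 2 - y ^ 2)]

section Mixture

variable {ι : Type*} [Fintype ι] {R : ℕ}

/-- The law of the `R` replications in one group: draw `J` uniformly, then sample independently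
from `ν J`. -/
noncomputable def mixLaw (ν : ι → Measure ℝ) (R : ℕ) : Measure (Fin R → ℝ) :=
  (Fintype.card ι : ℝ≥0∞)⁻¹ • ∑ J, Measure.pi fun _ : Fin R => ν J

variable {ν : ι → Measure ℝ}

theorem mixLaw_apply (C : Set (Fin R → ℝ)) :
    mixLaw ν R C = (Fintype.card ι : ℝ≥0∞)⁻¹ * ∑ J, (Measure.pi fun _ : Fin R => ν J) C := by
  simp [mixLaw]

instance [∀ J, IsProbabilityMeasure (ν J)] [Nonempty ι] : IsProbabilityMeasure (mixLaw ν R) :=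
  ⟨by rw [mixLaw_apply]; simp [ENNReal.inv_mul_cancel]⟩

theorem integrable_mixLaw {f : (Fin R → ℝ) → ℝ}
    [Nonempty ι]
    (h : ∀ J, Integrable f (Measure.pi fun _ : Fin R => ν J)) : Integrable f (mixLaw ν R) :=
  (integrable_finsetSum_measure.2 fun J _ => h J).smul_measure (by simp)

theorem integral_mixLaw {f : (Fin R → ℝ) → ℝ}
    (h : ∀ J, Integrable f (Measure.pi fun _ : Fin R => ν J)) :
    ∫ t, f t ∂(mixLaw ν R) = (∑ J, ∫ t, f t ∂(Measure.pi fun _ : Fin R => ν J))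
      / Fintype.card ι := by
  rw [mixLaw, integral_smul_measure, integral_finsetSum_measure fun J _ => h J]
  simp [div_eq_inv_mul]

/-- Given the resample J, the group mean is `a J` plus centred noise. The noise variance cancels
against `repVar` in expectation, so what is left is exactly the variance of `a J` over the
resamples. In the fourth moment the two sources of randomness are separated by (x + y)⁴ ≤ 8(x⁴ +
y⁴), giving 8 and 8 · 3 = 24. -/
theorem mixLaw_moments [∀ J, IsProbabilityMeasure (ν J)] [Nonempty ι] (hR : 2 ≤ R) (hν : ∀ J, MemLp (fun y : ℝ => y) 4 (ν J)) {a : ι → ℝ}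
    (ha : ∀ J, ∫ y, y ∂(ν J) = a J) {c : ℝ} (hc : c = (∑ J, a J) / Fintype.card ι) :
    MemLp repMean 4 (mixLaw ν R) ∧ MemLp repVar 2 (mixLaw ν R) ∧
    ∫ t, repMean t ∂(mixLaw ν R) = c ∧
    ∫ t, ((repMean t - c) ^ 2 - repVar t) ∂(mixLaw ν R)
      = (∑ J, (a J - c) ^ 2) / Fintype.card ι ∧
    ∫ t, (repMean t - c) ^ 4 ∂(mixLaw ν R) ≤ 8 * ((∑ J, (a J - c) ^ 4) / Fintype.card ι)
      + 24 * ((∑ J, ∫ y, (y - a J) ^ 4 ∂(ν J)) / Fintype.card ι) / (R : ℝ) ^ 2 ∧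
    ∫ t, repVar t ^ 2 ∂(mixLaw ν R)
      ≤ 4 * ((∑ J, ∫ y, (y - a J) ^ 4 ∂(ν J)) / Fintype.card ι) / (R : ℝ) ^ 2 := by
  have hZ : ∀ J, MemLp (repMean : (Fin R → ℝ) → ℝ) 4 (Measure.pi fun _ => ν J) :=
    fun J => memLp_repMean (hν J)
  have hU : ∀ J, MemLp (repVar : (Fin R → ℝ) → ℝ) 2 (Measure.pi fun _ => ν J) :=
    fun J => memLp_repVar hR (hν J)
  have hZs : ∀ (x : ℝ) J,
      MemLp (fun t : Fin R → ℝ => repMean t - x) 4 (Measure.pi fun _ => ν J) :=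
    fun x J => (hZ J).sub (memLp_const x)
  have hZp : ∀ (x : ℝ) J (k : ℕ), k ≤ 4 → Integrable (fun t : Fin R → ℝ => (repMean t - x) ^ k)
      (Measure.pi fun _ => ν J) := fun x J k hk => integrable_pow_of_memLp_four (hZs x J) hk
  have M := fun J => repMean_moments hR (hν J) (ha J)
  have hUi : ∀ J, Integrable (repVar : (Fin R → ℝ) → ℝ) (Measure.pi fun _ => ν J) :=
    fun J => (hU J).integrable (by norm_num)
  refine ⟨memLp_four_of_integrable measurable_repMean.aestronglyMeasurable
    (integrable_mixLaw fun J => integrable_pow_of_memLp_four (hZ J) le_rfl),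
    (memLp_two_iff_integrable_sq measurable_repVar.aestronglyMeasurable).2
    (integrable_mixLaw fun J => (hU J).integrable_sq), ?_, ?_, ?_, ?_⟩
  · rw [integral_mixLaw fun J => (hZ J).integrable (by norm_num), hc]
    congr 1
    refine Finset.sum_congr rfl fun J _ => ?_
    have := (M J).1
    rw [integral_sub ((hZ J).integrable (by norm_num)) (integrable_const _)] at this
    simp at this
    linarith
  · rw [integral_mixLaw fun J => (hZp c J 2 (by norm_num)).sub' (hUi J)]
    congr 1
    refine Finset.sum_congr rfl fun J _ => ?_
    -- Recentring at `a J`: the linear term has mean zero, and the first square cancels with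
    -- `repVar` in mean.
    have e : ∀ t : Fin R → ℝ, (repMean t - c) ^ 2 - repVar t = (repMean t - a J) ^ 2
        + 2 * (a J - c) * (repMean t - a J) + (a J - c) ^ 2 - repVar t := fun t => by ring
    have i1 := hZp (a J) J 2 (by norm_num)
    have i2 := ((hZs (a J) J).integrable (by norm_num)).const_mul (2 * (a J - c))
    simp_rw [e]
    rw [integral_sub ((i1.fun_add i2).fun_add (integrable_const _)) (hUi J),
      integral_add (i1.fun_add i2) (integrable_const _), integral_add i1 i2, integral_const_mul,
      (M J).1, (M J).2.1]
    simp
  · rw [integral_mixLaw fun J => hZp c J 4 le_rfl]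
    have e : 8 * ((∑ J, (a J - c) ^ 4) / (Fintype.card ι : ℝ))
        + 24 * ((∑ J, ∫ y, (y - a J) ^ 4 ∂(ν J)) / Fintype.card ι) / (R : ℝ) ^ 2
        = (∑ J, (8 * (a J - c) ^ 4 + 8 * (3 * (∫ y, (y - a J) ^ 4 ∂(ν J)) / (R : ℝ) ^ 2)))
          / Fintype.card ι := by
      rw [Finset.sum_add_distrib, ← Finset.mul_sum, ← Finset.mul_sum, ← Finset.sum_div,
        ← Finset.mul_sum]
      ring
    rw [e]
    gcongr with J
    calc ∫ t : Fin R → ℝ, (repMean t - c) ^ 4 ∂(Measure.pi fun _ => ν J)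
        ≤ ∫ t : Fin R → ℝ, (8 * (a J - c) ^ 4 + 8 * (repMean t - a J) ^ 4)
          ∂(Measure.pi fun _ => ν J) := by
          refine integral_mono (hZp c J 4 le_rfl)
            ((integrable_const _).fun_add ((hZp (a J) J 4 le_rfl).const_mul 8)) fun t => ?_
          simpa only [sub_add_sub_cancel', mul_add] using add_pow_four_le (a J - c) (repMean t - a J)
      _ = 8 * (a J - c) ^ 4 + 8 * ∫ t : Fin R → ℝ, (repMean t - a J) ^ 4
          ∂(Measure.pi fun _ => ν J) := by
          rw [integral_add (integrable_const _) ((hZp (a J) J 4 le_rfl).const_mul 8),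
            integral_const_mul]
          simp [integral_const_mul]
      _ ≤ _ := by gcongr; exact (M J).2.2.1
  · rw [integral_mixLaw fun J => (hU J).integrable_sq]
    have e : 4 * ((∑ J, ∫ y, (y - a J) ^ 4 ∂(ν J)) / Fintype.card ι) / (R : ℝ) ^ 2
        = (∑ J, 4 * (∫ y, (y - a J) ^ 4 ∂(ν J)) / (R : ℝ) ^ 2) / Fintype.card ι := by
      rw [← Finset.sum_div, ← Finset.mul_sum]
      ring
    rw [e]
    gcongr with J
    exact (M J).2.2.2

end Mixture

/-! ### Concentration of the estimator for a fixed data set -/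

section Concentration

variable {ι : Type*} [Fintype ι] [Nonempty ι] {B R : ℕ} {ν : ι → Measure ℝ}
  [∀ J, IsProbabilityMeasure (ν J)]

/-- Concentration of the estimator around the variance of the means `a J` of the laws `ν J`. -/
theorem svbEstimator_concentration (hB : 2 ≤ B) (hR : 2 ≤ R)
    (hν : ∀ J, MemLp (fun y : ℝ => y) 4 (ν J)) {a : ι → ℝ} (ha : ∀ J, ∫ y, y ∂(ν J) = a J)
    {c : ℝ} (hc : c = (∑ J, a J) / Fintype.card ι) {s δ : ℝ} (hs : 0 < s) (hδ : 0 < δ) :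
    (Measure.pi fun _ : Fin B => mixLaw ν R).real
      {y | δ ≤ s * |svbEstimator 1 y - (∑ J, (a J - c) ^ 2) / Fintype.card ι|}
      ≤ (8 / δ + 8 / δ ^ 2) * (1 / B + 8 * (s ^ 2 * ((∑ J, (a J - c) ^ 4) / Fintype.card ι)) / B
        + 28 * (s ^ 2 / (B * (R : ℝ) ^ 2)
          * ((∑ J, ∫ y, (y - a J) ^ 4 ∂(ν J)) / Fintype.card ι))) := by
  obtain ⟨h1, h2, h3, h4, h5, h6⟩ := mixLaw_moments (R := R) hR hν ha hc
  have hσ : ∫ t, ((repMean t - ∫ t, repMean t ∂(mixLaw ν R)) ^ 2 - repVar t) ∂(mixLaw ν R)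
      = (∑ J, (a J - c) ^ 2) / Fintype.card ι := by rw [h3]; exact h4
  have key := pi_sampleVar_concentration (B := B) hB h1 h2 hσ hs hδ
  simp only [h3] at key
  simp_rw [svbEstimator_eq, one_mul]
  refine key.trans ?_
  set w := ∫ t, (repMean t - c) ^ 4 ∂(mixLaw ν R)
  set u := ∫ t, repVar t ^ 2 ∂(mixLaw ν R)
  set M := (∑ J, (a J - c) ^ 4) / (Fintype.card ι : ℝ)
  set K := (∑ J, ∫ y, (y - a J) ^ 4 ∂(ν J)) / (Fintype.card ι : ℝ)
  have hB0 : (0 : ℝ) < B := by positivity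
  have hR0 : (0 : ℝ) < R := by positivity
  -- The constant 28 collects 24 from the group mean and 4 from `repVar`.
  have e : (8 / δ + 8 / δ ^ 2) * (1 / B + 8 * (s ^ 2 * M) / B
      + 28 * (s ^ 2 / (B * (R : ℝ) ^ 2) * K)) = (8 / δ + 8 / δ ^ 2) *
        (1 + s ^ 2 * (8 * M + 24 * K / (R : ℝ) ^ 2) + s ^ 2 * (4 * K / (R : ℝ) ^ 2)) / B := by
    field_simp
    ring
  rw [e]
  gcongr

end Concentration

/-! ### Conditional law of the output given the data -/

section Kernel

variable {D ι : Type*} [MeasurableSpace D] [Fintype ι] {B R : ℕ}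

theorem measurable_pi_measure_const {T : Type*} [MeasurableSpace T] {ν : D → Measure T}
    [∀ x, IsProbabilityMeasure (ν x)] (hν : Measurable ν) :
    Measurable fun x => Measure.pi fun _ : Fin B => ν x := by
  refine .measure_of_isPiSystem_of_isProbabilityMeasure generateFrom_pi.symm isPiSystem_pi ?_
  rintro _ ⟨C, hC, rfl⟩
  simp_rw [Measure.pi_pi]
  exact Finset.measurable_prod _ fun b _ =>
    (Measure.measurable_coe (hC b (Set.mem_univ b))).comp hν

theorem measurable_mixLaw {ν : D → ι → Measure ℝ} [∀ x J, IsProbabilityMeasure (ν x J)]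
    (hν : ∀ J, Measurable fun x => ν x J) : Measurable fun x => mixLaw (ν x) R := by
  refine Measure.measurable_of_measurable_coe _ fun C hC => ?_
  simp_rw [mixLaw_apply]
  exact (Finset.measurable_sum _ fun J _ =>
    (Measure.measurable_coe hC).comp (measurable_pi_measure_const (hν J))).const_mul _

/-- The conditional law of the output of the algorithm given the data. -/
noncomputable def outputKernel [Nonempty ι] (ν : D → ι → Measure ℝ) [∀ x J, IsProbabilityMeasure (ν x J)]
    (hν : ∀ J, Measurable fun x => ν x J) (B R : ℕ) : ProbabilityTheory.Kernel D (Fin B → Fin R → ℝ) where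
  toFun x := Measure.pi fun _ => mixLaw (ν x) R
  measurable' := measurable_pi_measure_const (measurable_mixLaw hν)

variable {ν : D → ι → Measure ℝ} [∀ x J, IsProbabilityMeasure (ν x J)]
    {hν : ∀ J, Measurable fun x => ν x J}

theorem outputKernel_apply [Nonempty ι] (x : D) :
    outputKernel ν hν B R x = Measure.pi fun _ => mixLaw (ν x) R := rfl

instance [Nonempty ι] : IsMarkovKernel (outputKernel ν hν B R) :=
  ⟨fun x => by rw [outputKernel_apply]; infer_instance⟩

/-- Expanding the product over b of averages over one resample gives one average over all B-tuples
of resamples. This is the form in which a run of the algorithm is described. -/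
theorem outputKernel_rectangle [Nonempty ι] (x : D) (C : Fin B → Fin R → Set ℝ) :
    outputKernel ν hν B R x (Set.univ.pi fun b => Set.univ.pi (C b))
      = (Fintype.card (Fin B → ι) : ℝ≥0∞)⁻¹ *
        ∑ j : Fin B → ι, ∏ b, ∏ r, ν x (j b) (C b r) := by
  classical
  rw [outputKernel_apply, Measure.pi_pi]
  simp_rw [mixLaw_apply, Measure.pi_pi]
  rw [Finset.prod_mul_distrib, Finset.prod_univ_sum]
  simp [ENNReal.inv_pow]

variable {Ω : Type*} [MeasurableSpace Ω] {μ : Measure Ω} [IsProbabilityMeasure μ]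
  [MeasurableSpace ι] [MeasurableSingletonClass ι]

/-- The joint law of the data and the output of the algorithm. -/
theorem map_data_output [Nonempty ι] (hν : ∀ J, Measurable fun x => ν x J) {X : Ω → D} (hX : Measurable X)
    {J : Ω → Fin B → ι} (hJ : Measurable J) (hJu : μ.map J = uniformOn Set.univ)
    (hXJ : IndepFun X J μ) {Y : Ω → Fin B → Fin R → ℝ} (hY : Measurable Y)
    (hlaw : ∀ A : Set D, MeasurableSet A →
      ∀ C : Fin B → Fin R → Set ℝ, (∀ b r, MeasurableSet (C b r)) →
      μ {ω | X ω ∈ A ∧ ∀ b r, Y ω b r ∈ C b r} =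
        ∫⁻ ω in {ω | X ω ∈ A}, ∏ b, ∏ r, ν (X ω) (J ω b) (C b r) ∂μ) :
    μ.map (fun ω => (X ω, Y ω)) = (μ.map X) ⊗ₘ (outputKernel ν hν B R) := by
  have hXY : Measurable fun ω => (X ω, Y ω) := hX.prodMk hY
  have : IsProbabilityMeasure (μ.map fun ω => (X ω, Y ω)) := Measure.isProbabilityMeasure_map hXY.aemeasurable
  have : IsProbabilityMeasure (μ.map X) := Measure.isProbabilityMeasure_map hX.aemeasurable
  -- On rectangles, independence of data and indices allows the uniform indices to be integrated out
  -- first.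
  have rect : ∀ A : Set D, MeasurableSet A → ∀ C : Fin B → Fin R → Set ℝ,
      (∀ b r, MeasurableSet (C b r)) →
      (μ.map fun ω => (X ω, Y ω)) (A ×ˢ Set.univ.pi fun b => Set.univ.pi (C b))
        = ((μ.map X) ⊗ₘ (outputKernel ν hν B R)) (A ×ˢ Set.univ.pi fun b => Set.univ.pi (C b)) := by
    intro A hA C hC
    have hCm : MeasurableSet (Set.univ.pi fun b => Set.univ.pi (C b)) :=
      MeasurableSet.univ_pi fun b => MeasurableSet.univ_pi (hC b)
    rw [Measure.map_apply hXY (hA.prod hCm), Measure.compProd_apply_prod hA hCm]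
    have e : (fun ω => (X ω, Y ω)) ⁻¹' (A ×ˢ Set.univ.pi fun b => Set.univ.pi (C b))
        = {ω | X ω ∈ A ∧ ∀ b r, Y ω b r ∈ C b r} := by
      ext ω; simp
    rw [e, hlaw A hA C hC]
    have hΦ : Measurable fun p : D × (Fin B → ι) => ∏ b, ∏ r, ν p.1 (p.2 b) (C b r) := by
      refine measurable_from_prod_countable_left fun j => ?_
      exact Finset.measurable_prod _ fun b _ => Finset.measurable_prod _ fun r _ =>
        (Measure.measurable_coe (hC b r)).comp (hν (j b))
    have hmap : μ.map (fun ω => (X ω, J ω)) = (μ.map X).prod (μ.map J) :=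
      (indepFun_iff_map_prod_eq_prod_map_map hX.aemeasurable hJ.aemeasurable).1 hXJ
    have hset : {ω | X ω ∈ A} = (fun ω => (X ω, J ω)) ⁻¹' (A ×ˢ Set.univ) := by ext; simp
    rw [hset, ← setLIntegral_map (hA.prod MeasurableSet.univ) hΦ (hX.prodMk hJ), hmap,
      Measure.prod_restrict _ _ |>.symm, Measure.restrict_univ, lintegral_prod _ hΦ.aemeasurable]
    refine lintegral_congr fun x => ?_
    rw [outputKernel_rectangle, hJu, lintegral_fintype, Finset.mul_sum]
    refine Finset.sum_congr rfl fun j _ => ?_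
    rw [uniformOn_univ]
    simp [mul_comm, div_eq_mul_inv]
  refine Measure.ext_prod fun {A D'} hA hD' => ?_
  -- For a fixed data event A, both sides are finite measures in the output event. They agree on the
  -- nested rectangles, a generating π-system, and hence everywhere.
  set m1 := ((μ.map fun ω => (X ω, Y ω)).restrict (A ×ˢ Set.univ)).map Prod.snd
  set m2 := (((μ.map X) ⊗ₘ (outputKernel ν hν B R)).restrict (A ×ˢ Set.univ)).map Prod.snd
  have r1 : ∀ T : Set (Fin B → Fin R → ℝ), MeasurableSet T →
      m1 T = (μ.map fun ω => (X ω, Y ω)) (A ×ˢ T) := fun T hT => by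
    rw [Measure.map_apply measurable_snd hT, Measure.restrict_apply (measurable_snd hT)]
    congr 1; ext; simp [and_comm]
  have r2 : ∀ T : Set (Fin B → Fin R → ℝ), MeasurableSet T →
      m2 T = ((μ.map X) ⊗ₘ (outputKernel ν hν B R)) (A ×ˢ T) := fun T hT => by
    rw [Measure.map_apply measurable_snd hT, Measure.restrict_apply (measurable_snd hT)]
    congr 1; ext; simp [and_comm]
  rw [← r1 D' hD', ← r2 D' hD']
  congr 1
  refine ext_of_generate_finite
    (Set.univ.pi '' Set.univ.pi fun _ : Fin B =>
      (Set.univ.pi '' Set.univ.pi fun _ : Fin R => {C : Set ℝ | MeasurableSet C})) ?_ ?_ ?_ ?_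
  · refine Eq.trans ?_ (generateFrom_pi_eq fun b =>
      IsCountablySpanning.pi fun _ => isCountablySpanning_measurableSet)
    congr 1
    funext b
    exact generateFrom_pi.symm
  · exact IsPiSystem.pi fun b => isPiSystem_pi
  · rintro _ ⟨c, hc, rfl⟩
    choose C hC hC' using fun b => hc b (Set.mem_univ b)
    obtain rfl : (fun b => Set.univ.pi (C b)) = c := funext hC'
    have hCm : ∀ b r, MeasurableSet (C b r) := fun b r => hC b r (Set.mem_univ r)
    have hm : MeasurableSet (Set.univ.pi fun b => Set.univ.pi (C b)) :=
      MeasurableSet.univ_pi fun b => MeasurableSet.univ_pi (hCm b)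
    rw [r1 _ hm, r2 _ hm, rect A hA C hCm]
  · have := rect A hA (fun _ _ => Set.univ) fun _ _ => MeasurableSet.univ
    simp only [Set.pi_univ] at this
    rw [r1 _ MeasurableSet.univ, r2 _ MeasurableSet.univ, this]

end Kernel

/-! ### Extending the simulator to data outside the supports -/

section ProbPart

/-- Turns a measure on `ℝ` into a probability measure, keeping it if it is one. -/
noncomputable def probPart (ν : Measure ℝ) : Measure ℝ :=
  open Classical in if ν Set.univ = 1 then ν else Measure.dirac 0

instance (ν : Measure ℝ) : IsProbabilityMeasure (probPart ν) := by
  unfold probPart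
  split_ifs with h
  · exact ⟨h⟩
  · infer_instance

theorem probPart_eq (ν : Measure ℝ) [IsProbabilityMeasure ν] : probPart ν = ν := by
  simp [probPart]

theorem measurable_probPart : Measurable probPart := by
  classical
  exact Measurable.ite (Measure.measurable_coe MeasurableSet.univ (measurableSet_singleton 1))
    measurable_id measurable_const

end ProbPart

/-! ### Convergence in probability as convergence along a filter -/

section ProbFilter

variable {Ω : Type*} [MeasurableSpace Ω] {μ : Measure Ω}

/-- The filter on `ℕ × Ω` along which convergence is convergence in probability. -/
def probFilter (μ : Measure Ω) : Filter (ℕ × Ω) where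
  sets := {A | Tendsto (fun k => μ {ω | (k, ω) ∉ A}) atTop (𝓝 0)}
  univ_sets := by simp
  sets_of_superset {A A'} hA h := tendsto_of_tendsto_of_tendsto_of_le_of_le tendsto_const_nhds hA
    (fun _ => zero_le) fun k => measure_mono fun ω hω hA' => hω (h hA')
  inter_sets {A A'} hA hA' := by
    have hA : Tendsto (fun k => μ {ω | (k, ω) ∉ A}) atTop (𝓝 0) := hA
    have hA' : Tendsto (fun k => μ {ω | (k, ω) ∉ A'}) atTop (𝓝 0) := hA'
    have hs : Tendsto (fun k => μ {ω | (k, ω) ∉ A} + μ {ω | (k, ω) ∉ A'}) atTop (𝓝 0) := by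
      simpa using hA.add hA'
    refine tendsto_of_tendsto_of_tendsto_of_le_of_le tendsto_const_nhds hs (fun _ => zero_le)
      fun k => (measure_mono fun ω hω => ?_).trans (measure_union_le _ _)
    simp only [Set.mem_ofPred_eq, Set.mem_inter_iff, Set.mem_union] at hω ⊢
    tauto

theorem eventually_probFilter {P : ℕ × Ω → Prop} :
    (∀ᶠ p in probFilter μ, P p) ↔ Tendsto (fun k => μ {ω | ¬ P (k, ω)}) atTop (𝓝 0) := Iff.rfl

/-- Through this equivalence, sums, products, square roots and squeezing of limits in probability
are the ordinary rules for `Tendsto`, and almost sure or deterministic facts become eventual ones.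
No measurability of f is involved. -/
theorem tendstoInMeasure_iff_probFilter {f : ℕ → Ω → ℝ} {c : ℝ} :
    TendstoInMeasure μ f atTop (fun _ => c)
      ↔ Tendsto (fun p : ℕ × Ω => f p.1 p.2) (probFilter μ) (𝓝 c) := by
  rw [tendstoInMeasure_iff_dist, Metric.tendsto_nhds]
  simp_rw [eventually_probFilter, not_lt]

theorem tendsto_fst_probFilter : Tendsto Prod.fst (probFilter μ) atTop := by
  rw [tendsto_atTop]
  intro k₀
  rw [eventually_probFilter]
  refine tendsto_const_nhds.congr' ?_
  filter_upwards [eventually_ge_atTop k₀] with k hk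
  simp [hk]

theorem eventually_probFilter_of_ae {P : ℕ → Ω → Prop} (h : ∀ᶠ k in atTop, ∀ᵐ ω ∂μ, P k ω) :
    ∀ᶠ p in probFilter μ, P p.1 p.2 := by
  rw [eventually_probFilter]
  refine tendsto_const_nhds.congr' ?_
  filter_upwards [h] with k hk
  exact (ae_iff.1 hk).symm

/-- The rule O_p(1) · o(1) = o_p(1). Finiteness is recorded separately because `toReal` sends ∞ to 0
and would hide an infinite moment. -/
theorem IsBigOpOne.mul_tendsto_zero {u : ℕ → Ω → ℝ≥0∞} (hu : IsBigOpOne μ u) {w : ℕ → ℝ}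
    (hw : Tendsto w atTop (𝓝 0)) :
    (∀ᶠ p in probFilter μ, u p.1 p.2 ≠ ∞) ∧
    Tendsto (fun p : ℕ × Ω => w p.1 * (u p.1 p.2).toReal) (probFilter μ) (𝓝 0) := by
  constructor
  · rw [eventually_probFilter, ENNReal.tendsto_nhds_zero]
    intro ε hε
    obtain ⟨M, hM⟩ := hu ε hε
    filter_upwards [hM] with k hk
    refine (measure_mono fun ω hω => ?_).trans hk.le
    simp only [Set.mem_ofPred_eq, not_not] at hω ⊢
    rw [hω]; exact ENNReal.coe_lt_top
  · rw [Metric.tendsto_nhds]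
    intro δ hδ
    rw [eventually_probFilter, ENNReal.tendsto_nhds_zero]
    intro ε hε
    obtain ⟨M, hM⟩ := hu ε hε
    have hw' : ∀ᶠ k in atTop, |w k| * M < δ := by
      have : Tendsto (fun k => |w k| * M) atTop (𝓝 0) := by simpa using hw.abs.mul_const (M : ℝ)
      exact this.eventually_lt_const hδ
    filter_upwards [hM, hw'] with k hk hk'
    refine (measure_mono fun ω hω => ?_).trans hk.le
    simp only [Set.mem_ofPred_eq, not_lt, dist_zero_right, Real.norm_eq_abs, abs_mul,
      ENNReal.abs_toReal] at hω ⊢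
    by_contra! hcon
    have h1 : (u k ω).toReal ≤ M := by
      simpa using ENNReal.toReal_mono ENNReal.coe_ne_top hcon
    have := mul_le_mul_of_nonneg_left h1 (abs_nonneg (w k))
    linarith

theorem tendsto_probFilter_of_tendsto_lintegral {f : ℕ → Ω → ℝ}
    (hf : ∀ᶠ k in atTop, AEMeasurable (f k) μ)
    (h : Tendsto (fun k => ∫⁻ ω, ‖f k ω‖ₑ ∂μ) atTop (𝓝 0)) :
    Tendsto (fun p : ℕ × Ω => f p.1 p.2) (probFilter μ) (𝓝 0) := by
  rw [Metric.tendsto_nhds]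
  intro δ hδ
  rw [eventually_probFilter]
  have hδ' : ENNReal.ofReal δ ≠ 0 := by simpa using hδ
  have h' : Tendsto (fun k => (∫⁻ ω, ‖f k ω‖ₑ ∂μ) / ENNReal.ofReal δ) atTop (𝓝 0) := by
    simpa using ENNReal.Tendsto.div_const h (Or.inr hδ')
  refine tendsto_of_tendsto_of_tendsto_of_le_of_le' tendsto_const_nhds h'
    (Eventually.of_forall fun _ => zero_le) ?_
  filter_upwards [hf] with k hk
  refine (measure_mono fun ω hω => ?_).trans
    (meas_ge_le_lintegral_div hk.enorm hδ' ENNReal.ofReal_ne_top)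
  simp only [Set.mem_ofPred_eq, not_lt, dist_zero_right] at hω ⊢
  rw [← ofReal_norm]
  exact ENNReal.ofReal_le_ofReal hω

/-- Bounded convergence: q is at most ε/2 off an event of probability at most ε/2, and at most 1 on
it. It removes the conditioning on the data. -/
theorem tendsto_lintegral_of_probFilter [IsProbabilityMeasure μ] {q : ℕ → Ω → ℝ≥0∞}
    (hq : ∀ᶠ k in atTop, Measurable (q k)) (hq1 : ∀ᶠ k in atTop, ∀ ω, q k ω ≤ 1)
    (h : Tendsto (fun p : ℕ × Ω => q p.1 p.2) (probFilter μ) (𝓝 0)) :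
    Tendsto (fun k => ∫⁻ ω, q k ω ∂μ) atTop (𝓝 0) := by
  rw [ENNReal.tendsto_nhds_zero] at h ⊢
  intro ε hε
  have hε2 : 0 < ε / 2 := ENNReal.half_pos hε.ne'
  have h2 := h (ε / 2) hε2
  rw [eventually_probFilter, ENNReal.tendsto_nhds_zero] at h2
  filter_upwards [hq, hq1, h2 (ε / 2) hε2] with k hk hk1 hk2
  have hm : MeasurableSet {ω | ¬ q k ω ≤ ε / 2} := (measurableSet_le hk measurable_const).compl
  calc ∫⁻ ω, q k ω ∂μ
      ≤ ∫⁻ ω, (ε / 2 + {ω | ¬ q k ω ≤ ε / 2}.indicator 1 ω) ∂μ := by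
        refine lintegral_mono fun ω => ?_
        by_cases hω : q k ω ≤ ε / 2
        · exact hω.trans le_self_add
        · simp only [Set.indicator, Set.mem_ofPred_eq, hω, not_false_eq_true, if_true]
          exact (hk1 ω).trans le_add_self
    _ = ε / 2 + μ {ω | ¬ q k ω ≤ ε / 2} := by
        rw [lintegral_add_left measurable_const, lintegral_indicator_one hm]
        simp
    _ ≤ ε / 2 + ε / 2 := by gcongr
    _ = ε := ENNReal.add_halves ε

end ProbFilter

/-! ### Empirical distributions -/

section Empirical

theorem integral_empirical {α : Type*} [MeasurableSpace α] [MeasurableSingletonClass α] {s : ℕ}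
    (x : Fin s → α) (f : α → ℝ) : ∫ y, f y ∂(empirical x) = (∑ l, f (x l)) / s := by
  rw [empirical, integral_smul_measure, integral_finsetSum_measure fun l _ =>
    integrable_dirac (by simp)]
  simp [div_eq_inv_mul]

theorem empirical_mem_hullClass {α : Type*} [TopologicalSpace α] [MeasurableSpace α]
    {F : Measure α} {s : ℕ} (hs : 0 < s) {x : Fin s → α} (hx : ∀ l, x l ∈ F.support) :
    empirical x ∈ hullClass F := by
  have hs0 : (s : ℝ≥0) ≠ 0 := by exact_mod_cast hs.ne'
  refine ⟨s, 0, fun _ => (s : ℝ≥0)⁻¹, x, hx, by simp [hs0], ?_⟩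
  rw [empirical, zero_smul, zero_add, ← Finset.smul_sum, ENNReal.smul_def, ENNReal.coe_inv hs0]
  simp

theorem self_mem_hullClass {α : Type*} [TopologicalSpace α] [MeasurableSpace α]
    (F : Measure α) : F ∈ hullClass F :=
  ⟨0, 1, fun _ => 0, fun l => l.elim0, fun l => l.elim0, by simp, by simp⟩

variable {m : ℕ} {E : Fin m → Type*} [∀ i, MeasurableSpace (E i)]

theorem mixedInput_univ {n s : Fin m → ℕ} (x : ∀ i, ℕ → E i) (J : ResampleIndex n s) :
    mixedInput Finset.univ x J = resampledInput x J := by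
  funext i; simp [mixedInput]

/-- The empirical law forgets the order of the points; with i.i.d. data this makes the observations
exchangeable. -/
theorem empirical_comp_perm {α : Type*} [MeasurableSpace α] {s : ℕ} (x : Fin s → α)
    (τ : Equiv.Perm (Fin s)) : empirical (fun l => x (τ l)) = empirical x := by
  rw [empirical, empirical, Equiv.sum_comp τ fun l => Measure.dirac (x l)]

end Empirical

/-! ### Moments under resampling -/

section Star

variable {m : ℕ} {n s : Fin m → ℕ}

/-- Moving the centre from p to the mean c costs 8(p − c)⁴ by convexity, and Jensen bounds (p − c)⁴
by the fourth moment about p; hence 16 = 8 + 8. The mean of the resampled ψ need not be known. -/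
theorem integral_pow_four_sub_integral_le {Ω : Type*} [MeasurableSpace Ω] {μ : Measure Ω}
    [IsProbabilityMeasure μ] {f : Ω → ℝ} (hf : MemLp f 4 μ) (p : ℝ) :
    ∫ ω, (f ω - ∫ ω, f ω ∂μ) ^ 4 ∂μ ≤ 16 * ∫ ω, (f ω - p) ^ 4 ∂μ := by
  set c := ∫ ω, f ω ∂μ with hc
  have hfp : MemLp (fun ω => f ω - p) 4 μ := hf.sub (memLp_const p)
  have i4 := integrable_pow_of_memLp_four hfp le_rfl
  have hcp : (p - c) ^ 4 ≤ ∫ ω, (f ω - p) ^ 4 ∂μ := by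
    have h1 := sq_integral_le (hfp.mono_exponent (by norm_num : (2 : ℝ≥0∞) ≤ 4))
    have h2 := sq_integral_sq_le hfp
    rw [integral_sub (hf.integrable (by norm_num)) (integrable_const p)] at h1
    simp only [integral_const, probReal_univ, smul_eq_mul, one_mul] at h1
    calc (p - c) ^ 4 = ((c - p) ^ 2) ^ 2 := by ring
      _ ≤ (∫ ω, (f ω - p) ^ 2 ∂μ) ^ 2 := pow_le_pow_left₀ (by positivity) h1 2
      _ ≤ _ := h2
  calc ∫ ω, (f ω - c) ^ 4 ∂μ ≤ ∫ ω, (8 * (f ω - p) ^ 4 + 8 * (p - c) ^ 4) ∂μ := by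
        refine integral_mono (integrable_pow_of_memLp_four (hf.sub (memLp_const c)) le_rfl)
          ((i4.const_mul 8).fun_add (integrable_const _)) fun ω => ?_
        simpa only [sub_add_sub_cancel, mul_add] using add_pow_four_le (f ω - p) (p - c)
    _ = 8 * ∫ ω, (f ω - p) ^ 4 ∂μ + 8 * (p - c) ^ 4 := by
        rw [integral_add (i4.const_mul 8) (integrable_const _), integral_const_mul]; simp
    _ ≤ _ := by linarith

/-- Moments, under resampling, of a statistic that is a centered linear statistic up to a
constant and a remainder. -/
theorem starMean_expansion [∀ i, NeZero (n i)] (hs : ∀ i, 0 < s i) {h : ∀ i, Fin (n i) → ℝ}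
    (h0 : ∀ i, ∑ j, h i j = 0) {a e : ResampleIndex n s → ℝ} {p : ℝ}
    (ha : ∀ J, a J = p + ∑ i, (∑ l, h i (J i l)) / s i + e J) :
    |starMean (fun J => (a J - starMean a) ^ 2) - ∑ i, ((∑ j, h i j ^ 2) / n i) / s i|
      ≤ 2 * √(∑ i, ((∑ j, h i j ^ 2) / n i) / s i) * √√(starMean fun J => e J ^ 4)
        + √(starMean fun J => e J ^ 4) ∧
    starMean (fun J => (a J - starMean a) ^ 4)
      ≤ 128 * (3 * (∑ i, √((∑ j, h i j ^ 4) / n i) / s i) ^ 2 + starMean fun J => e J ^ 4) := by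
  obtain ⟨l1, l2, l4⟩ := starMean_linear hs h h0
  set L : ResampleIndex n s → ℝ := fun J => ∑ i, (∑ l, h i (J i l)) / s i with hL
  change starMean L = 0 at l1
  change starMean (fun J => L J ^ 2) = _ at l2
  change starMean (fun J => L J ^ 4) ≤ _ at l4
  rw [← l2]
  have ha' : ∀ J, a J = p + L J + e J := ha
  simp only [starMean_eq_integral] at l1 l4 ⊢
  have hLM : ∀ (f : ResampleIndex n s → ℝ) (q : ℝ≥0∞), MemLp f q (drawLaw n s) :=
    fun f q => MemLp.of_discrete
  constructor
  · have v1 : ∫ J, (a J - ∫ J, a J ∂(drawLaw n s)) ^ 2 ∂(drawLaw n s)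
        = variance (fun J => L J + e J) (drawLaw n s) := by
      rw [← variance_eq_integral (hLM a 2).aemeasurable]
      have : a = fun J => p + (L J + e J) := by ext J; rw [ha' J]; ring
      rw [this, variance_const_add (hLM _ 2).aestronglyMeasurable]
    have v2 : variance L (drawLaw n s) = ∫ J, L J ^ 2 ∂(drawLaw n s) :=
      variance_of_integral_eq_zero (hLM L 2).aemeasurable l1
    have h1 := abs_variance_add_sub_le (hLM L 2) (hLM e 2)
    -- The remainder is controlled only in fourth mean; Jensen brings this down to the second moment
    -- that perturbs the variance.
    have h2 : ∫ J, e J ^ 2 ∂(drawLaw n s) ≤ √(∫ J, e J ^ 4 ∂(drawLaw n s)) :=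
      Real.le_sqrt_of_sq_le (sq_integral_sq_le (hLM e 4))
    rw [v1, ← v2]
    refine h1.trans ?_
    gcongr
  · refine (integral_pow_four_sub_integral_le (hLM a 4) p).trans ?_
    have : ∫ J, (a J - p) ^ 4 ∂(drawLaw n s)
        ≤ 8 * (∫ J, L J ^ 4 ∂(drawLaw n s) + ∫ J, e J ^ 4 ∂(drawLaw n s)) := by
      rw [← integral_add (integrable_pow_of_memLp_four (hLM L 4) le_rfl)
        (integrable_pow_of_memLp_four (hLM e 4) le_rfl), ← integral_const_mul]
      refine integral_mono (integrable_pow_of_memLp_four (hLM (fun J => a J - p) 4) le_rfl)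
        (((integrable_pow_of_memLp_four (hLM L 4) le_rfl).fun_add
        (integrable_pow_of_memLp_four (hLM e 4) le_rfl)).const_mul 8) fun J => ?_
      have e1 : a J - p = L J + e J := by rw [ha' J]; ring
      simp only [e1]
      exact add_pow_four_le _ _
    linarith

/-- Second empirical moments of two families are close if the families are. -/
theorem abs_avg_sq_sub_le {N : ℕ} (f h : Fin N → ℝ) :
    |(∑ j, h j ^ 2) / N - (∑ j, f j ^ 2) / N|
      ≤ 2 * √((∑ j, f j ^ 2) / N) * √√((∑ j, (h j - f j) ^ 4) / N)
        + √((∑ j, (h j - f j) ^ 4) / N) := by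
  set d : Fin N → ℝ := fun j => h j - f j with hd
  change _ ≤ 2 * √((∑ j, f j ^ 2) / N) * √√((∑ j, d j ^ 4) / N) + √((∑ j, d j ^ 4) / N)
  have hN : (0 : ℝ) ≤ N := by positivity
  have h4 : (∑ j, d j ^ 2) / N ≤ √((∑ j, d j ^ 4) / N) := by
    refine Real.le_sqrt_of_sq_le ?_
    have := sq_sum_le_card_mul_sum_sq (s := Finset.univ) (f := fun j => d j ^ 2)
    simp only [← pow_mul, Finset.card_univ, Fintype.card_fin] at this
    rcases hN.eq_or_lt with h0 | h0
    · simp [← h0]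
    rw [div_pow, div_le_div_iff₀ (by positivity) h0]
    calc (∑ j, d j ^ 2) ^ 2 * N ≤ (N * ∑ j, d j ^ 4) * N := by gcongr
      _ = _ := by ring
  -- h² − f² = 2 f d + d² with d = h − f; the cross term is handled by Cauchy–Schwarz.
  have e : (∑ j, h j ^ 2) / N - (∑ j, f j ^ 2) / N
      = 2 * ((∑ j, f j * d j) / N) + (∑ j, d j ^ 2) / N := by
    rw [div_sub_div_same, ← Finset.sum_sub_distrib, ← mul_div_assoc, Finset.mul_sum, ← add_div,
      ← Finset.sum_add_distrib]
    congr 1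
    refine Finset.sum_congr rfl fun j _ => ?_
    simp only [hd]; ring
  have hcs : |(∑ j, f j * d j) / N| ≤ √((∑ j, f j ^ 2) / N) * √((∑ j, d j ^ 2) / N) := by
    rw [← Real.sqrt_mul (by positivity)]
    refine Real.abs_le_sqrt ?_
    rw [div_pow, div_mul_div_comm, ← sq]
    gcongr
    exact Finset.sum_mul_sq_le_sq_mul_sq _ _ _
  have hd2 : 0 ≤ (∑ j, d j ^ 2) / (N : ℝ) := by positivity
  calc |(∑ j, h j ^ 2) / N - (∑ j, f j ^ 2) / N|
      ≤ |2 * ((∑ j, f j * d j) / N)| + |(∑ j, d j ^ 2) / (N : ℝ)| := by rw [e]; exact abs_add_le _ _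
    _ = 2 * |(∑ j, f j * d j) / N| + (∑ j, d j ^ 2) / N := by
        rw [abs_mul, abs_of_nonneg hd2]; norm_num
    _ ≤ 2 * (√((∑ j, f j ^ 2) / N) * √((∑ j, d j ^ 2) / N)) + (∑ j, d j ^ 2) / N := by gcongr
    _ ≤ 2 * (√((∑ j, f j ^ 2) / N) * √√((∑ j, d j ^ 4) / N)) + √((∑ j, d j ^ 4) / N) := by
        gcongr
    _ = _ := by ring

theorem avg_pow_four_le {N : ℕ} (f h : Fin N → ℝ) :
    (∑ j, h j ^ 4) / N ≤ 8 * ((∑ j, f j ^ 4) / N + (∑ j, (h j - f j) ^ 4) / N) := by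
  rw [← add_div, ← mul_div_assoc, ← Finset.sum_add_distrib, Finset.mul_sum]
  gcongr with j
  simpa using add_pow_four_le (f j) (h j - f j)

end Star

/-! ### Exchangeability and the law of large numbers -/

section Data

variable {m : ℕ} {E : Fin m → Type*} [∀ i, MeasurableSpace (E i)]
  {F : ∀ i, Measure (E i)} {Ω : Type*} [MeasurableSpace Ω] {μ : Measure Ω}
  {X : ∀ i, ℕ → Ω → E i}

theorem IsData.measurePreserving (hX : IsData μ F X) (i : Fin m) (j : ℕ) :
    MeasurePreserving (X i j) μ (F i) := ⟨hX.measurable i j, hX.law i j⟩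

/-- Unbiasedness and centring are assumed on `hullClass` only. Second countability gives the support
full measure, so empirical and resampled inputs of positive size lie in that class almost surely. -/
theorem IsData.ae_mem_support [∀ i, TopologicalSpace (E i)]
    [∀ i, SecondCountableTopology (E i)] [∀ i, BorelSpace (E i)] (hX : IsData μ F X) :
    ∀ᵐ ω ∂μ, ∀ i j, X i j ω ∈ (F i).support := by
  rw [ae_all_iff]; intro i
  rw [ae_all_iff]; intro j
  exact (hX.measurePreserving i j).quasiMeasurePreserving.ae (Measure.support_mem_ae (μ := F i))

theorem IsData.comp_perm (hX : IsData μ F X) (τ : Fin m → Equiv.Perm ℕ) :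
    IsData μ F fun i j => X i (τ i j) where
  measurable i j := hX.measurable i _
  law i j := hX.law i _
  indep := hX.indep.precomp (g := fun p : Fin m × ℕ => (p.1, τ p.1 p.2)) fun p q h => by
    obtain ⟨i, j⟩ := p
    obtain ⟨i', j'⟩ := q
    simp only [Prod.mk.injEq] at h
    obtain ⟨rfl, h⟩ := h
    simpa using h

theorem IsData.iIndepFun_sigma (hX : IsData μ F X) (n : Fin m → ℕ) :
    iIndepFun (fun (p : (i : Fin m) × Fin (n i)) => X p.1 p.2) μ :=
  hX.indep.precomp (g := fun p : (i : Fin m) × Fin (n i) => (p.1, (p.2 : ℕ))) fun p q h => by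
    obtain ⟨i, j⟩ := p
    obtain ⟨i', j'⟩ := q
    simp only [Prod.mk.injEq] at h
    obtain ⟨rfl, h⟩ := h
    simpa [Fin.ext_iff] using h

theorem IsData.measurable_dataVec (hX : IsData μ F X) (n : Fin m → ℕ) :
    Measurable fun ω i (j : Fin (n i)) => X i j ω :=
  measurable_pi_lambda _ fun i => measurable_pi_lambda _ fun j => hX.measurable i j

/-- Two data sets with the same input models have the same law. -/
theorem IsData.map_dataVec_eq [IsProbabilityMeasure μ] (hX : IsData μ F X)
    {X' : ∀ i, ℕ → Ω → E i} (hX' : IsData μ F X') (n : Fin m → ℕ) :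
    μ.map (fun ω i (j : Fin (n i)) => X i j ω) = μ.map (fun ω i (j : Fin (n i)) => X' i j ω) := by
  have key : ∀ {Z : ∀ i, ℕ → Ω → E i}, IsData μ F Z →
      μ.map (fun ω i (j : Fin (n i)) => Z i j ω)
        = (Measure.pi fun p : (i : Fin m) × Fin (n i) => F p.1).map
          (MeasurableEquiv.piCurry fun i (_ : Fin (n i)) => E i) := by
    intro Z hZ
    have hm : Measurable fun ω (p : (i : Fin m) × Fin (n i)) => Z p.1 p.2 ω :=
      measurable_pi_lambda _ fun p => hZ.measurable _ _
    have h := (iIndepFun_iff_map_fun_eq_pi_map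
      (f := fun (p : (i : Fin m) × Fin (n i)) => Z p.1 p.2)
      (fun p => (hZ.measurable _ _).aemeasurable)).1 (hZ.iIndepFun_sigma n)
    simp only [hZ.law] at h
    rw [← h, Measure.map_map (MeasurableEquiv.measurable _) hm]
    rfl
  rw [key hX, key hX']

theorem empiricalInput_swap {n : Fin m → ℕ} (x : ∀ i, ℕ → E i) {i : Fin m} {j : ℕ}
    (hj : j < n i) :
    empiricalInput n (fun i' j' => x i' ((if i' = i then Equiv.swap 0 j else 1 : Equiv.Perm ℕ) j'))
      = empiricalInput n x := by
  funext i'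
  by_cases h : i' = i
  · subst h
    simp only [empiricalInput, if_true]
    have := empirical_comp_perm (fun l : Fin (n i') => x i' l)
      (Equiv.swap ⟨0, by omega⟩ ⟨j, hj⟩)
    rw [← this]
    congr 1
    funext l
    congr 1
    rw [Equiv.swap_apply_def, Equiv.swap_apply_def]
    simp only [Fin.ext_iff]
    split_ifs <;> rfl
  · simp [empiricalInput, h]

/-- The observations play exchangeable roles. -/
theorem IsData.lintegral_exchange [IsProbabilityMeasure μ] (hX : IsData μ F X) {n : Fin m → ℕ}
    {i : Fin m} {Φ : (∀ i, Measure (E i)) → E i → ℝ≥0∞}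
    (hΦ : Measurable fun z : (∀ i', Fin (n i') → E i') × E i =>
      Φ (fun i' => empirical (z.1 i')) z.2) {j : ℕ} (hj : j < n i) :
    ∫⁻ ω, Φ (empiricalInput n fun i j => X i j ω) (X i j ω) ∂μ
      = ∫⁻ ω, Φ (empiricalInput n fun i j => X i j ω) (X i 0 ω) ∂μ := by
  set τ : Fin m → Equiv.Perm ℕ := fun i' => if i' = i then Equiv.swap 0 j else 1 with hτ
  have hX' := hX.comp_perm τ
  -- Both integrands are the same function of the finite data vector, once for the original order
  -- and once with observations 0 and j of input i exchanged; the two vectors have the same law.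
  set G : (∀ i', Fin (n i') → E i') → ℝ≥0∞ := fun z =>
    Φ (fun i' => empirical (z i')) (z i ⟨0, by omega⟩) with hG
  have hGm : Measurable G := by
    have : Measurable fun z : ∀ i', Fin (n i') → E i' => (z, z i ⟨0, by omega⟩) := by fun_prop
    have h := hΦ.comp this
    simp only [Function.comp_def] at h
    exact h
  have e0 : ∀ ω, Φ (empiricalInput n fun i j => X i j ω) (X i 0 ω)
      = G (fun i (j : Fin (n i)) => X i j ω) := fun ω => rfl
  have e1 : ∀ ω, Φ (empiricalInput n fun i j => X i j ω) (X i j ω)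
      = G (fun i (j : Fin (n i)) => X i (τ i j) ω) := fun ω => by
    have := empiricalInput_swap (n := n) (fun i j => X i j ω) hj
    rw [← this]
    have h0 : τ i 0 = j := by simp [hτ]
    simp only [hG, h0]
    rfl
  simp_rw [e0, e1]
  rw [← lintegral_map hGm (hX.measurable_dataVec n), hX.map_dataVec_eq hX' n,
    lintegral_map hGm (hX'.measurable_dataVec n)]

/-- Law of large numbers along the data sizes of one input. -/
theorem IsData.tendsto_avg [IsProbabilityMeasure μ] (hX : IsData μ F X) {n : ℕ → ℕ}
    (hn : Tendsto n atTop atTop) (i : Fin m) {f : E i → ℝ} (hf : Integrable f (F i)) :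
    Tendsto (fun p : ℕ × Ω => (∑ j : Fin (n p.1), f (X i j p.2)) / n p.1) (probFilter μ)
      (𝓝 (∫ x, f x ∂(F i))) := by
  -- A measurable version is needed to transfer independence and identical distribution to f(X);
  -- almost surely it agrees with f at all observations at once.
  set f' := hf.aestronglyMeasurable.mk f with hf'
  have hfm : Measurable f' := hf.aestronglyMeasurable.stronglyMeasurable_mk.measurable
  have hff : f =ᵐ[F i] f' := hf.aestronglyMeasurable.ae_eq_mk
  have hae : ∀ᵐ ω ∂μ, ∀ j, f (X i j ω) = f' (X i j ω) := by
    rw [ae_all_iff]; intro j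
    exact (hX.measurePreserving i j).quasiMeasurePreserving.ae hff
  have hint : Integrable (fun ω => f' (X i 0 ω)) μ :=
    (hX.measurePreserving i 0).integrable_comp_of_integrable (hf.congr hff)
  have hmean : ∫ ω, f' (X i 0 ω) ∂μ = ∫ x, f x ∂(F i) := by
    rw [integral_congr_ae hff, ← hX.law i 0, integral_map (hX.measurable i 0).aemeasurable
      hfm.aestronglyMeasurable]
  have hsl := strong_law_ae_real (μ := μ) (fun j ω => f' (X i j ω)) hint
    (fun j j' hjj => by
      have h1 : IndepFun (X i j) (X i j') μ :=
        hX.indep.indepFun (i := (i, j)) (j := (i, j')) (by simpa using hjj)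
      exact h1.comp hfm hfm)
    (fun j => by
      have : IdentDistrib (X i j) (X i 0) μ μ :=
        ⟨(hX.measurable i j).aemeasurable, (hX.measurable i 0).aemeasurable, by
          rw [hX.law, hX.law]⟩
      exact this.comp hfm)
  have hT : TendstoInMeasure μ
      (fun k ω => (∑ j : Fin (n k), f' (X i j ω)) / n k) atTop fun _ => ∫ x, f x ∂(F i) := by
    refine tendstoInMeasure_of_tendsto_ae (fun k => Measurable.aestronglyMeasurable ?_) ?_
    · exact (Finset.measurable_fun_sum _ fun (j : Fin (n k)) _ =>
        hfm.comp (hX.measurable i j)).div_const _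
    · filter_upwards [hsl] with ω hω
      have := hω.comp hn
      simp only [hmean] at this
      refine this.congr fun k => ?_
      simp only [Function.comp_apply]
      rw [Fin.sum_univ_eq_sum_range (fun j => f' (X i j ω))]
  rw [tendstoInMeasure_iff_probFilter] at hT
  refine hT.congr' ?_
  have := eventually_probFilter_of_ae (μ := μ) (P := fun _ ω => ∀ j, f (X i j ω) = f' (X i j ω))
    (Eventually.of_forall fun _ => hae)
  filter_upwards [this] with p hp
  simp_rw [hp]

variable [∀ i, TopologicalSpace (E i)]
  {ψ : (∀ i, Measure (E i)) → ℝ} {g : ∀ i, (∀ i, Measure (E i)) → E i → ℝ}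

/-- The influence functions at the empirical and at the true input models are close, on average
over the observations. -/
theorem tendsto_avg_influence_sub [IsProbabilityMeasure μ] (hX : IsData μ F X)
    (hd : GateauxDifferentiable F ψ g) {n : ℕ → Fin m → ℕ}
    (hn : ∀ᶠ k in atTop, ∀ i, 0 < n k i) (i : Fin m)
    (h : Tendsto (fun k => ∫⁻ ω, ‖g i (empiricalInput (n k) fun i' j => X i' j ω) (X i 0 ω)
      - g i F (X i 0 ω)‖ₑ ^ 4 ∂μ) atTop (𝓝 0)) :
    Tendsto (fun p : ℕ × Ω => (∑ j : Fin (n p.1 i),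
      (g i (empiricalInput (n p.1) fun i' j => X i' j p.2) (X i j p.2) - g i F (X i j p.2)) ^ 4)
        / n p.1 i) (probFilter μ) (𝓝 0) := by
  have hgF : AEStronglyMeasurable (g i F) (F i) :=
    (hd.integrable F F (fun i => self_mem_hullClass _) (fun i => self_mem_hullClass _)
      i).aestronglyMeasurable
  set f := hgF.mk (g i F)
  have hfm : Measurable f := hgF.stronglyMeasurable_mk.measurable
  have hae : ∀ j, (fun ω => g i F (X i j ω)) =ᵐ[μ] fun ω => f (X i j ω) := fun j =>
    (hX.measurePreserving i j).quasiMeasurePreserving.ae hgF.ae_eq_mk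
  have hgm : ∀ᶠ k in atTop, ∀ j,
      Measurable fun ω => g i (empiricalInput (n k) fun i' j => X i' j ω) (X i j ω) := by
    filter_upwards [hn] with k hk j
    have h := (hd.measurable (n k) hk i).comp
      ((hX.measurable_dataVec (n k)).prodMk (hX.measurable i j))
    simp only [Function.comp_def] at h
    exact h
  have ham : ∀ᶠ k in atTop, ∀ j, AEMeasurable (fun ω =>
      (g i (empiricalInput (n k) fun i' j => X i' j ω) (X i j ω) - g i F (X i j ω)) ^ 4) μ := by
    filter_upwards [hgm] with k hk j
    have h1 : AEMeasurable (fun ω => g i F (X i j ω)) μ :=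
      AEMeasurable.congr (hfm.comp (hX.measurable i j)).aemeasurable (hae j).symm
    have h2 : AEMeasurable (fun ω => g i (empiricalInput (n k) fun i' j => X i' j ω) (X i j ω)
        - g i F (X i j ω)) μ := (hk j).aemeasurable.sub h1
    exact h2.pow_const 4
  refine tendsto_probFilter_of_tendsto_lintegral (f := fun k ω => (∑ j : Fin (n k i),
    (g i (empiricalInput (n k) fun i' j => X i' j ω) (X i j ω) - g i F (X i j ω)) ^ 4)
      / n k i) ?_ ?_
  · filter_upwards [ham] with k hk
    exact (Finset.aemeasurable_fun_sum _ fun (j : Fin (n k i)) _ => hk j).div_const _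
  · refine tendsto_of_tendsto_of_tendsto_of_le_of_le' tendsto_const_nhds h
      (Eventually.of_forall fun _ => zero_le) ?_
    filter_upwards [ham, hn] with k hk hnk
    -- By exchangeability each of the n_i terms has the expectation of the term for observation 0,
    -- so the average has that expectation too and Markov's inequality applies.
    have hex : ∀ j : Fin (n k i), ∫⁻ ω, ‖(g i (empiricalInput (n k) fun i' j => X i' j ω) (X i j ω)
        - g i F (X i j ω)) ^ 4‖ₑ ∂μ = ∫⁻ ω, ‖g i (empiricalInput (n k) fun i' j => X i' j ω)
          (X i 0 ω) - g i F (X i 0 ω)‖ₑ ^ 4 ∂μ := by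
      intro j
      have c : ∀ j : ℕ, ∫⁻ ω, ‖g i (empiricalInput (n k) fun i' j => X i' j ω) (X i j ω)
          - g i F (X i j ω)‖ₑ ^ 4 ∂μ = ∫⁻ ω, ‖g i (empiricalInput (n k) fun i' j => X i' j ω)
            (X i j ω) - f (X i j ω)‖ₑ ^ 4 ∂μ := fun j => by
        refine lintegral_congr_ae ?_
        filter_upwards [hae j] with ω hω
        rw [hω]
      simp_rw [enorm_pow]
      rw [c, c]
      have h1 := ((hd.measurable (n k) hnk i).sub (hfm.comp measurable_snd)).enorm.pow_const 4
      simp only [Function.comp_def] at h1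
      exact hX.lintegral_exchange (Φ := fun P y => ‖g i P y - f y‖ₑ ^ 4) h1 j.2
    calc ∫⁻ ω, ‖(∑ j : Fin (n k i), (g i (empiricalInput (n k) fun i' j => X i' j ω) (X i j ω)
          - g i F (X i j ω)) ^ 4) / (n k i : ℝ)‖ₑ ∂μ
        ≤ ∫⁻ ω, (∑ j : Fin (n k i), ‖(g i (empiricalInput (n k) fun i' j => X i' j ω) (X i j ω)
          - g i F (X i j ω)) ^ 4‖ₑ) * (n k i : ℝ≥0∞)⁻¹ ∂μ := by
          refine lintegral_mono fun ω => ?_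
          rw [div_eq_mul_inv, enorm_mul]
          have h0 : (n k i : ℝ) ≠ 0 := by exact_mod_cast (hnk i).ne'
          rw [enorm_inv h0]
          have h1 : ‖(n k i : ℝ)‖ₑ = (n k i : ℝ≥0∞) := by
            rw [Real.enorm_eq_ofReal (by positivity), ENNReal.ofReal_natCast]
          rw [h1]
          gcongr
          exact enorm_sum_le _ _
      _ = (∑ j : Fin (n k i), ∫⁻ ω, ‖(g i (empiricalInput (n k) fun i' j => X i' j ω) (X i j ω)
          - g i F (X i j ω)) ^ 4‖ₑ ∂μ) * (n k i : ℝ≥0∞)⁻¹ := by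
          rw [lintegral_mul_const' _ _ (by simp [(hnk i).ne']),
            lintegral_finsetSum' _ fun (j : Fin (n k i)) _ => (hk j).enorm]
      _ = ∫⁻ ω, ‖g i (empiricalInput (n k) fun i' j => X i' j ω) (X i 0 ω)
          - g i F (X i 0 ω)‖ₑ ^ 4 ∂μ := by
          simp_rw [hex]
          rw [Finset.sum_const, Finset.card_univ, Fintype.card_fin, nsmul_eq_mul, mul_comm,
            ← mul_assoc, ENNReal.inv_mul_cancel (by simp [(hnk i).ne']) (by simp), one_mul]
      _ ≤ _ := le_rfl

end Data

/-! ### Measurability of the simulator in the data -/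

section Simulator

variable {m : ℕ} {E : Fin m → Type*} [∀ i, MeasurableSpace (E i)] [∀ i, TopologicalSpace (E i)]
  {F : ∀ i, Measure (E i)} {ψ : (∀ i, Measure (E i)) → ℝ}
  {S : (∀ i, Measure (E i)) → Measure ℝ}

theorem resampledInput_mem_hullClass {n s : Fin m → ℕ} (hs : ∀ i, 0 < s i) {x : ∀ i, ℕ → E i}
    (hx : ∀ i j, x i j ∈ (F i).support) (J : ResampleIndex n s) (i : Fin m) :
    resampledInput x J i ∈ hullClass (F i) :=
  empirical_mem_hullClass (hs i) fun _ => hx i _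

theorem empiricalInput_mem_hullClass {n : Fin m → ℕ} (hn : ∀ i, 0 < n i) {x : ∀ i, ℕ → E i}
    (hx : ∀ i j, x i j ∈ (F i).support) (i : Fin m) : empiricalInput n x i ∈ hullClass (F i) :=
  empirical_mem_hullClass (hn i) fun _ => hx i _

theorem IsSimulator.measurable_resampled (hS : IsSimulator F ψ S) {n s : Fin m → ℕ}
    (hs : ∀ i, 0 < s i) (J : ResampleIndex n s) :
    Measurable fun x : ∀ i, ℕ → E i => S (resampledInput x J) := by
  have h : Measurable fun (x : ∀ i, ℕ → E i) i (l : Fin (s i)) => x i (J i l) := by fun_prop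
  have h' := (hS.measurable s hs).comp h
  simp only [Function.comp_def] at h'
  exact h'

theorem IsSimulator.measurable_empirical (hS : IsSimulator F ψ S) {n : Fin m → ℕ}
    (hn : ∀ i, 0 < n i) : Measurable fun x : ∀ i, ℕ → E i => S (empiricalInput n x) := by
  have h : Measurable fun (x : ∀ i, ℕ → E i) i (l : Fin (n i)) => x i l := by fun_prop
  have h' := (hS.measurable n hn).comp h
  simp only [Function.comp_def] at h'
  exact h'

theorem IsSimulator.probPart_eq (hS : IsSimulator F ψ S) {P : ∀ i, Measure (E i)}
    (hP : ∀ i, P i ∈ hullClass (F i)) : probPart (S P) = S P := by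
  have := hS.prob P hP
  exact InputUncertainty.probPart_eq _

/-- Gives measurability of ψ at empirical inputs, where ψ is the mean of the simulation law. -/
theorem measurable_integral_id {D : Type*} [MeasurableSpace D] {ν : D → Measure ℝ}
    [∀ x, IsProbabilityMeasure (ν x)] (hν : Measurable ν) :
    Measurable fun x => ∫ y, y ∂(ν x) := by
  let κ : ProbabilityTheory.Kernel D ℝ := ⟨ν, hν⟩
  have : IsMarkovKernel κ := ⟨fun x => inferInstanceAs (IsProbabilityMeasure (ν x))⟩
  exact (StronglyMeasurable.integral_kernel (κ := κ) (f := fun y : ℝ => y)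
    stronglyMeasurable_id).measurable

end Simulator

/-! ### Asymptotics of the input variance -/

section InputVariance

variable {m : ℕ} {E : Fin m → Type*} [∀ i, MeasurableSpace (E i)]
  {F : ∀ i, Measure (E i)}
  {ψ : (∀ i, Measure (E i)) → ℝ} {S : (∀ i, Measure (E i)) → Measure ℝ}
  {g : ∀ i, (∀ i, Measure (E i)) → E i → ℝ}
  {Ω : Type*} [MeasurableSpace Ω] {μ : Measure Ω}
  {X : ∀ i, ℕ → Ω → E i}

/-- The variance of the first order approximation of `ψ` at the empirical input models. -/
noncomputable def linearVar (F : ∀ i, Measure (E i)) (g : ∀ i, (∀ i, Measure (E i)) → E i → ℝ)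
    (n : Fin m → ℕ) : ℝ :=
  ∑ i, variance (g i F) (F i) / n i

theorem variance_linear (hX : IsData μ F X) (hg : ∀ i, MemLp (g i F) 2 (F i)) (n : Fin m → ℕ)
    (hn : ∀ i, 0 < n i) :
    MemLp (fun ω => ∑ i, (∑ j : Fin (n i), g i F (X i j ω)) / n i) 2 μ ∧
    variance (fun ω => ∑ i, (∑ j : Fin (n i), g i F (X i j ω)) / n i) μ = linearVar F g n := by
  set Z : (i : Fin m) × Fin (n i) → Ω → ℝ := fun p ω => g p.1 F (X p.1 p.2 ω) / n p.1 with hZ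
  have e : (fun ω => ∑ i, (∑ j : Fin (n i), g i F (X i j ω)) / n i) = ∑ p, Z p := by
    ext ω
    simp only [Finset.sum_apply, Z]
    rw [Fintype.sum_sigma]
    simp_rw [Finset.sum_div]
  have hgd : ∀ i, MemLp (fun y => g i F y / n i) 2 (F i) := fun i => by
    simpa [div_eq_inv_mul] using (hg i).const_mul (n i : ℝ)⁻¹
  have hZL : ∀ p, MemLp (Z p) 2 μ := fun p =>
    (hgd p.1).comp_measurePreserving (hX.measurePreserving p.1 p.2)
  have hind : iIndepFun Z μ :=
    (hX.iIndepFun_sigma n).comp₀ (fun p y => g p.1 F y / n p.1)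
      (fun p => (hX.measurable _ _).aemeasurable)
      fun p => by rw [hX.law]; exact (hgd p.1).aemeasurable
  rw [e]
  refine ⟨memLp_finsetSum' _ fun p _ => hZL p, ?_⟩
  rw [IndepFun.variance_sum (fun p _ => hZL p) fun p _ q _ hpq => hind.indepFun hpq,
    linearVar, Fintype.sum_sigma]
  refine Finset.sum_congr rfl fun i _ => ?_
  have hv : ∀ j : Fin (n i), variance (Z ⟨i, j⟩) μ = variance (g i F) (F i) / (n i : ℝ) ^ 2 := by
    intro j
    have h1 := (hX.measurePreserving i j).variance_fun_comp (hgd i).aemeasurable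
    have h2 : (fun y => g i F y / (n i : ℝ)) = fun y => (n i : ℝ)⁻¹ * g i F y := by
      ext y; rw [div_eq_inv_mul]
    rw [h2, variance_const_mul] at h1
    rw [div_eq_inv_mul, ← inv_pow, ← h1]
  simp_rw [hv]
  have : (n i : ℝ) ≠ 0 := by exact_mod_cast (hn i).ne'
  rw [Finset.sum_const, Finset.card_univ, Fintype.card_fin, nsmul_eq_mul]
  field_simp

theorem linearVar_pos (hm : 0 < m) (hσ : ∀ i, 0 < variance (g i F) (F i)) {n : Fin m → ℕ}
    (hn : ∀ i, 0 < n i) : 0 < linearVar F g n := by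
  have : Nonempty (Fin m) := ⟨⟨0, hm⟩⟩
  exact Finset.sum_pos (fun i _ => div_pos (hσ i) (by exact_mod_cast hn i)) Finset.univ_nonempty

/-- Keeps one term of the sum. It bounds the weights 1/(n_i v) uniformly, whatever the relative
sizes of the data sets. -/
theorem variance_le_mul_linearVar (hσ : ∀ i, 0 < variance (g i F) (F i)) {n : Fin m → ℕ}
    (hn : ∀ i, 0 < n i) (i : Fin m) : variance (g i F) (F i) ≤ n i * linearVar F g n := by
  have hni : (0 : ℝ) < n i := by exact_mod_cast hn i
  rw [← div_le_iff₀' hni]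
  exact Finset.single_le_sum (f := fun i => variance (g i F) (F i) / (n i : ℝ))
    (fun i _ => div_nonneg (hσ i).le (by positivity)) (Finset.mem_univ i)

/-- `1 / linearVar` is at most of the order of the average data size. -/
theorem exists_inv_linearVar_le (hm : 0 < m) (hσ : ∀ i, 0 < variance (g i F) (F i)) :
    ∃ C : ℝ, 0 < C ∧ ∀ n : Fin m → ℕ, (∀ i, 0 < n i) → 1 / linearVar F g n ≤ C * avgSize n := by
  set i₀ : Fin m := ⟨0, hm⟩
  have hm' : (0 : ℝ) < m := by exact_mod_cast hm
  -- One input suffices: v ≥ σ²/n for input i₀, and n for that input is at most m times the average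
  -- size.
  refine ⟨m / variance (g i₀ F) (F i₀), div_pos hm' (hσ i₀), fun n hn => ?_⟩
  have h1 := variance_le_mul_linearVar hσ hn i₀
  have hv := linearVar_pos hm hσ hn
  have h2 : (n i₀ : ℝ) ≤ m * avgSize n := by
    rw [avgSize, mul_div_cancel₀ _ hm'.ne']
    exact Finset.single_le_sum (f := fun i => (n i : ℝ)) (fun i _ => by positivity)
      (Finset.mem_univ i₀)
  rw [div_le_iff₀ hv, div_mul_eq_mul_div, div_mul_eq_mul_div, le_div_iff₀ (hσ i₀), one_mul]
  exact h1.trans (mul_le_mul_of_nonneg_right h2 hv.le)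

variable [∀ i, TopologicalSpace (E i)] [∀ i, SecondCountableTopology (E i)] [∀ i, T1Space (E i)]
  [∀ i, BorelSpace (E i)] [∀ i, IsProbabilityMeasure (F i)] [IsProbabilityMeasure μ]

/-- The input variance is asymptotically the variance of the first order approximation. -/
theorem tendsto_inputVar_div_linearVar (hm : 0 < m) (hS : IsSimulator F ψ S) (hX : IsData μ F X)
    {n : ℕ → Fin m → ℕ} (hn : ∀ᶠ k in atTop, ∀ i, 0 < n k i) (hd : GateauxDifferentiable F ψ g)
    (ht : SmoothAtTruth μ F ψ g X n) :
    Tendsto (fun k => inputVar μ ψ X (n k) / linearVar F g (n k)) atTop (𝓝 1) := by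
  obtain ⟨C, hC, hCv⟩ := exists_inv_linearVar_le hm ht.nondegenerate
  set r : ℕ → Ω → ℝ := fun k ω => remainder ψ g F (empiricalInput (n k) fun i j => X i j ω) with hr
  set ρ : ℕ → ℝ≥0∞ := fun k => ENNReal.ofReal (avgSize (n k)) * ∫⁻ ω, ‖r k ω‖ₑ ^ 2 ∂μ with hρ
  have hρ0 : Tendsto ρ atTop (𝓝 0) := ht.remainder_small
  have hρr : Tendsto (fun k => C * (ρ k).toReal) atTop (𝓝 0) := by
    simpa using ((ENNReal.tendsto_toReal (by simp)).comp hρ0).const_mul C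
  have hg2 : ∀ i, MemLp (g i F) 2 (F i) := fun i => (ht.moment4 i).mono_exponent (by norm_num)
  have hbound : ∀ᶠ k in atTop, |inputVar μ ψ X (n k) / linearVar F g (n k) - 1|
      ≤ 2 * √(C * (ρ k).toReal) + C * (ρ k).toReal := by
    filter_upwards [hn, hρ0.eventually_lt_const (show (0 : ℝ≥0∞) < 1 by norm_num)] with k hk hk1
    obtain ⟨hL, hLv⟩ := variance_linear hX hg2 (n k) hk
    set L : Ω → ℝ := fun ω => ∑ i, (∑ j : Fin (n k i), g i F (X i j ω)) / n k i with hLdef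
    have hv := linearVar_pos hm ht.nondegenerate hk
    set v := linearVar F g (n k)
    have hN : 0 < avgSize (n k) := by
      have h1 := hCv (n k) hk
      have h2 : 0 < 1 / v := by positivity
      exact (pos_iff_pos_of_mul_pos (h2.trans_le h1)).1 hC
    have hexp : ∀ ω, ψ (empiricalInput (n k) fun i j => X i j ω) = ψ F + (L ω + r k ω) := by
      intro ω
      simp only [hr, remainder, hLdef]
      have h0 : ∀ i, ∫ x, g i F x ∂(F i) = 0 :=
        hd.centered F fun i => self_mem_hullClass _
      simp_rw [h0, empiricalInput, integral_empirical, sub_zero]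
      ring
    have hψm : AEMeasurable (fun ω => ψ (empiricalInput (n k) fun i j => X i j ω)) μ := by
      have hXm : Measurable fun ω i j => X i j ω :=
        measurable_pi_lambda _ fun i => measurable_pi_lambda _ fun j => hX.measurable i j
      have h1 : Measurable fun ω => ∫ y, y ∂(probPart
          (S (empiricalInput (n k) fun i j => X i j ω))) := by
        have := measurable_integral_id (ν := fun x : ∀ i, ℕ → E i =>
          probPart (S (empiricalInput (n k) x)))
          (measurable_probPart.comp (hS.measurable_empirical hk))
        exact this.comp hXm
      refine h1.aemeasurable.congr ?_
      filter_upwards [hX.ae_mem_support] with ω hω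
      have hP := empiricalInput_mem_hullClass (F := F) hk (x := fun i j => X i j ω) hω
      rw [hS.probPart_eq hP, hS.unbiased _ hP]
    have hrm : AEMeasurable (r k) μ := by
      have : r k = fun ω => ψ (empiricalInput (n k) fun i j => X i j ω) - (ψ F + L ω) := by
        ext ω; rw [hexp]; ring
      rw [this]
      exact hψm.sub (hL.aemeasurable.const_add _)
    -- Smallness of the scaled second moment, here below 1, rules out an infinite value, so the
    -- remainder is square integrable.
    have hfin : ∫⁻ ω, ‖r k ω‖ₑ ^ 2 ∂μ ≠ ∞ := by
      intro h
      have : ρ k = ∞ := by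
        simp only [hρ]; rw [h, ENNReal.mul_top (by simpa using hN)]
      rw [this] at hk1
      exact absurd hk1 (by simp)
    have hrL : MemLp (r k) 2 μ := by
      refine ⟨hrm.aestronglyMeasurable, ?_⟩
      rw [eLpNorm_lt_top_iff_lintegral_rpow_enorm_lt_top (by norm_num) (by norm_num)]
      simpa using hfin.lt_top
    have hrI : ∫ ω, r k ω ^ 2 ∂μ = (∫⁻ ω, ‖r k ω‖ₑ ^ 2 ∂μ).toReal := by
      rw [integral_eq_lintegral_of_nonneg_ae (ae_of_all _ fun ω => sq_nonneg _)
        (hrm.pow_const 2).aestronglyMeasurable]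
      congr 1
      refine lintegral_congr fun ω => ?_
      rw [← enorm_pow, Real.enorm_eq_ofReal (sq_nonneg _)]
    have hrρ : avgSize (n k) * ∫ ω, r k ω ^ 2 ∂μ = (ρ k).toReal := by
      simp only [hρ]
      rw [ENNReal.toReal_mul, ENNReal.toReal_ofReal hN.le, hrI]
    have hvar : inputVar μ ψ X (n k) = variance (fun ω => L ω + r k ω) μ := by
      rw [inputVar]
      simp_rw [hexp]
      exact variance_const_add (hL.aestronglyMeasurable.add hrL.aestronglyMeasurable) _
    have hkey := abs_variance_add_sub_le hL hrL
    rw [← hvar, hLv] at hkey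
    set Q := ∫ ω, r k ω ^ 2 ∂μ
    have hQ0 : 0 ≤ Q := integral_nonneg fun ω => sq_nonneg _
    have hQ : Q / v ≤ C * (ρ k).toReal := by
      rw [← hrρ, ← mul_assoc, div_eq_mul_one_div, mul_comm]
      exact mul_le_mul_of_nonneg_right (hCv _ hk) hQ0
    calc |inputVar μ ψ X (n k) / v - 1| = |inputVar μ ψ X (n k) - v| / v := by
          rw [← abs_of_pos hv, ← abs_div, abs_of_pos hv, sub_div, div_self hv.ne']
      _ ≤ (2 * √v * √Q + Q) / v := by gcongr
      _ = 2 * √(Q / v) + Q / v := by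
          have hs : 0 < √v := Real.sqrt_pos.2 hv
          rw [Real.sqrt_div hQ0, add_div, mul_assoc, mul_div_assoc]
          congr 2
          rw [div_eq_div_iff hv.ne' hs.ne']
          linear_combination √Q * Real.mul_self_sqrt hv.le
      _ ≤ _ := by gcongr
  have hlim : Tendsto (fun k => 2 * √(C * (ρ k).toReal) + C * (ρ k).toReal) atTop (𝓝 0) := by
    simpa using (hρr.sqrt.const_mul 2).add hρr
  rw [tendsto_iff_dist_tendsto_zero]
  exact tendsto_of_tendsto_of_tendsto_of_le_of_le' tendsto_const_nhds hlim
    (Eventually.of_forall fun _ => dist_nonneg) hbound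

end InputVariance

/-! ### Fixed data sizes: conditional concentration and linearization -/

section OneSize

variable {m : ℕ} {E : Fin m → Type*} [∀ i, MeasurableSpace (E i)] [∀ i, TopologicalSpace (E i)]
  {F : ∀ i, Measure (E i)} {ψ : (∀ i, Measure (E i)) → ℝ}
  {S : (∀ i, Measure (E i)) → Measure ℝ} {n s : Fin m → ℕ} {B R : ℕ}

/-- The variance of `ψ` at the resampled input models, conditional on the data. -/
noncomputable def starVar (ψ : (∀ i, Measure (E i)) → ℝ) (n s : Fin m → ℕ) (x : ∀ i, ℕ → E i) : ℝ :=
  starMean fun J : ResampleIndex n s => (ψ (resampledInput x J)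
    - starMean fun J : ResampleIndex n s => ψ (resampledInput x J)) ^ 2

/-- The fourth central moment of `ψ` at the resampled input models, conditional on the data. -/
noncomputable def starMoment4 (ψ : (∀ i, Measure (E i)) → ℝ) (n s : Fin m → ℕ) (x : ∀ i, ℕ → E i) :
    ℝ :=
  starMean fun J : ResampleIndex n s => (ψ (resampledInput x J)
    - starMean fun J : ResampleIndex n s => ψ (resampledInput x J)) ^ 4

/-- The conditional law of the output of the algorithm given the data. -/
noncomputable def outputLaw (S : (∀ i, Measure (E i)) → Measure ℝ) (n s : Fin m → ℕ) (B R : ℕ)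
    (x : ∀ i, ℕ → E i) : Measure (Fin B → Fin R → ℝ) :=
  Measure.pi fun _ => mixLaw (fun J : ResampleIndex n s => probPart (S (resampledInput x J))) R

/-- The abstract concentration bound at one data set lying in the supports, where `probPart` changes
nothing. A finite average over resamples forces every single fourth moment to be finite, so each
simulation law is in L⁴. -/
theorem conditional_concentration [∀ i, NeZero (n i)] (hS : IsSimulator F ψ S)
    (hs : ∀ i, 0 < s i) {x : ∀ i, ℕ → E i} (hx : ∀ i j, x i j ∈ (F i).support)
    (hB : 2 ≤ B) (hR : 2 ≤ R)
    (hu : (starMeanENN fun J : ResampleIndex n s => simMoment4 ψ S (resampledInput x J)) ≠ ∞)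
    {t δ : ℝ} (ht : 0 < t) (hδ : 0 < δ) :
    outputLaw S n s B R x {y | δ ≤ t * |svbEstimator 1 y - starVar ψ n s x|}
      ≤ ENNReal.ofReal ((8 / δ + 8 / δ ^ 2) * (1 / B + 8 * (t ^ 2 * starMoment4 ψ n s x) / B
        + 28 * (t ^ 2 / (B * (R : ℝ) ^ 2) * (starMeanENN fun J : ResampleIndex n s =>
          simMoment4 ψ S (resampledInput x J)).toReal))) := by
  have hP := fun J : ResampleIndex n s => resampledInput_mem_hullClass (F := F) hs hx J
  have hprob := fun J => hS.prob _ (hP J)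
  have hν : ∀ J : ResampleIndex n s, probPart (S (resampledInput x J)) = S (resampledInput x J) :=
    fun J => hS.probPart_eq (hP J)
  have hfin : ∀ J : ResampleIndex n s, simMoment4 ψ S (resampledInput x J) ≠ ∞ := by
    intro J hJ
    refine hu ?_
    rw [starMeanENN, ENNReal.div_eq_top]
    exact Or.inr ⟨ENNReal.sum_eq_top.2 ⟨J, Finset.mem_univ J, hJ⟩, ENNReal.natCast_ne_top _⟩
  have hint : ∀ J : ResampleIndex n s, ∫ y, (y - ψ (resampledInput x J)) ^ 4
      ∂(S (resampledInput x J)) = (simMoment4 ψ S (resampledInput x J)).toReal := fun J => by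
    rw [integral_eq_lintegral_of_nonneg_ae (ae_of_all _ fun y => by positivity)
      (by fun_prop), simMoment4]
    congr 1
    refine lintegral_congr fun y => ?_
    rw [← enorm_pow, Real.enorm_eq_ofReal (by positivity)]
  have hL : ∀ J : ResampleIndex n s, MemLp (fun y : ℝ => y) 4 (S (resampledInput x J)) := fun J => by
    have h1 : MemLp (fun y : ℝ => y - ψ (resampledInput x J)) 4 (S (resampledInput x J)) := by
      refine ⟨by fun_prop, ?_⟩
      rw [eLpNorm_lt_top_iff_lintegral_rpow_enorm_lt_top (by norm_num) (by norm_num)]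
      have := (hfin J).lt_top
      rw [simMoment4] at this
      simpa using this
    have := h1.add (memLp_const (ψ (resampledInput x J)))
    simpa [Pi.add_def] using this
  have key := svbEstimator_concentration (ι := ResampleIndex n s) (B := B) (R := R)
    (ν := fun J => probPart (S (resampledInput x J))) hB hR
    (fun J => by rw [hν]; exact hL J) (a := fun J => ψ (resampledInput x J))
    (fun J => by rw [hν]; exact hS.unbiased _ (hP J)) rfl ht hδ
  simp only [hν, hint] at key
  have hu' : (∑ J : ResampleIndex n s, (simMoment4 ψ S (resampledInput x J)).toReal)
      / Fintype.card (ResampleIndex n s) = (starMeanENN fun J : ResampleIndex n s =>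
          simMoment4 ψ S (resampledInput x J)).toReal := by
    rw [starMeanENN, ENNReal.toReal_div, ENNReal.toReal_sum fun J _ => hfin J]
    simp
  rw [hu'] at key
  simp only [outputLaw, hν]
  rw [← ENNReal.ofReal_toReal (measure_ne_top (Measure.pi fun _ : Fin B =>
    mixLaw (fun J : ResampleIndex n s => S (resampledInput x J)) R) _)]
  exact ENNReal.ofReal_le_ofReal key

/-- The linearization of the resampled performance measure, conditional on the data. -/
theorem starVar_expansion [∀ i, BorelSpace (E i)] [∀ i, T1Space (E i)] [∀ i, NeZero (n i)]
    {g : ∀ i, (∀ i, Measure (E i)) → E i → ℝ} (hd : GateauxDifferentiable F ψ g)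
    (hs : ∀ i, 0 < s i) {x : ∀ i, ℕ → E i} (hx : ∀ i j, x i j ∈ (F i).support) :
    |starVar ψ n s x
        - ∑ i, ((∑ j : Fin (n i), g i (empiricalInput n x) (x i j) ^ 2) / n i) / s i|
      ≤ 2 * √(∑ i, ((∑ j : Fin (n i), g i (empiricalInput n x) (x i j) ^ 2) / n i) / s i)
        * √√(starMean fun J : ResampleIndex n s =>
          remainder ψ g (empiricalInput n x) (mixedInput Finset.univ x J) ^ 4)
        + √(starMean fun J : ResampleIndex n s =>
          remainder ψ g (empiricalInput n x) (mixedInput Finset.univ x J) ^ 4) ∧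
    starMoment4 ψ n s x ≤ 128 * (3 * (∑ i, √((∑ j : Fin (n i),
      g i (empiricalInput n x) (x i j) ^ 4) / n i) / s i) ^ 2
        + starMean fun J : ResampleIndex n s =>
          remainder ψ g (empiricalInput n x) (mixedInput Finset.univ x J) ^ 4) := by
  have hP := empiricalInput_mem_hullClass (F := F) (n := n) (fun i => Nat.pos_of_neZero _) hx
  have hc := hd.centered _ hP
  -- Centring of ĝ_i under F̂_i is exactly the vanishing of this sum, so the linear term has mean
  -- zero under resampling.
  have h0 : ∀ i, ∑ j : Fin (n i), g i (empiricalInput n x) (x i j) = 0 := fun i => by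
    have h := hc i
    rw [empiricalInput, integral_empirical, div_eq_zero_iff] at h
    exact h.resolve_right (by simp [NeZero.ne (n i)])
  refine starMean_expansion hs (h := fun i j => g i (empiricalInput n x) (x i j)) h0
    (a := fun J => ψ (resampledInput x J)) (p := ψ (empiricalInput n x)) fun J => ?_
  simp only [remainder, mixedInput_univ, hc, sub_zero, resampledInput, integral_empirical]
  ring

variable [∀ i, SecondCountableTopology (E i)] [∀ i, BorelSpace (E i)]
  {Ω : Type*} [MeasurableSpace Ω] {μ : Measure Ω} [IsProbabilityMeasure μ]
  {X : ∀ i, ℕ → Ω → E i}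

/-- The probability of a deviation of the estimator, as the mean of a conditional probability. -/
theorem exists_measure_deviation_eq [∀ i, NeZero (n i)] (hS : IsSimulator F ψ S)
    (hX : IsData μ F X)
    (hs : ∀ i, 0 < s i) {J : Ω → Fin B → ResampleIndex n s} {Y : Ω → Fin B → Fin R → ℝ}
    (hrun : IsRun μ S X J Y) (t δ : ℝ) :
    ∃ q : Ω → ℝ≥0∞, Measurable q ∧ (∀ ω, q ω ≤ 1) ∧
      (∀ᵐ ω ∂μ, q ω = outputLaw S n s B R (fun i j => X i j ω)
        {y | δ ≤ t * |svbEstimator 1 y - starVar ψ n s fun i j => X i j ω|}) ∧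
      μ {ω | δ ≤ t * |svbEstimator 1 (Y ω) - starVar ψ n s fun i j => X i j ω|} = ∫⁻ ω, q ω ∂μ := by
  -- These are probability laws for every data set, depending measurably on it. Their means replace
  -- ψ throughout and agree with it almost surely, so the deviation event has a measurable version.
  set ν : (∀ i, ℕ → E i) → ResampleIndex n s → Measure ℝ :=
    fun x J => probPart (S (resampledInput x J)) with hνdef
  have hν : ∀ J, Measurable fun x => ν x J := fun J =>
    measurable_probPart.comp (hS.measurable_resampled hs J)
  have hprob : ∀ x J, IsProbabilityMeasure (ν x J) := fun x J => by
    simp only [hνdef]; infer_instance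
  set a : (∀ i, ℕ → E i) → ResampleIndex n s → ℝ := fun x J => ∫ y, y ∂(ν x J) with ha
  have ham : ∀ J, Measurable fun x => a x J := fun J => measurable_integral_id (hν J)
  set v : (∀ i, ℕ → E i) → ℝ := fun x =>
    starMean fun J : ResampleIndex n s => (a x J - starMean (a x)) ^ 2 with hv
  have hmean : Measurable fun x => starMean (a x) := by
    simp only [starMean]
    exact (Finset.measurable_fun_sum _ fun J _ => ham J).div_const _
  have hvm : Measurable v := by
    simp only [hv]
    have h1 : ∀ J, Measurable fun x => (a x J - starMean (a x)) ^ 2 := fun J =>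
      ((ham J).sub hmean).pow_const 2
    simp only [starMean] at h1 ⊢
    exact (Finset.measurable_fun_sum _ fun J _ => h1 J).div_const _
  have hXm : Measurable fun ω i j => X i j ω :=
    measurable_pi_lambda _ fun i => measurable_pi_lambda _ fun j => hX.measurable i j
  have hsvb : Measurable fun y : Fin B → Fin R → ℝ => svbEstimator 1 y := by
    simp only [svbEstimator, withinVar, grandMean, groupMean]
    fun_prop
  set D : Set ((∀ i, ℕ → E i) × (Fin B → Fin R → ℝ)) :=
    {z | δ ≤ t * |svbEstimator 1 z.2 - v z.1|} with hD
  have hDm : MeasurableSet D := by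
    refine measurableSet_le measurable_const (measurable_const.mul ?_)
    exact continuous_abs.measurable.comp
      ((hsvb.comp measurable_snd).sub (hvm.comp measurable_fst))
  have hae : ∀ᵐ ω ∂μ, v (fun i j => X i j ω) = starVar ψ n s fun i j => X i j ω := by
    filter_upwards [hX.ae_mem_support] with ω hω
    have hP := fun J : ResampleIndex n s =>
      resampledInput_mem_hullClass (F := F) (x := fun i j => X i j ω) hs hω J
    have : ∀ J, a (fun i j => X i j ω) J = ψ (resampledInput (fun i j => X i j ω) J) := fun J => by
      simp only [ha, hνdef]
      rw [hS.probPart_eq (hP J), hS.unbiased _ (hP J)]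
    simp only [hv, starVar]
    have e : a (fun i j => X i j ω)
        = fun J : ResampleIndex n s => ψ (resampledInput (fun i j => X i j ω) J) := funext this
    rw [e]
  have hlaw := map_data_output (μ := μ) (B := B) (R := R) hν hXm hrun.measurable_index
    hrun.index_uniform hrun.index_indep hrun.measurable_output (fun A hA C hC => by
      -- Only events about the data are needed; the indices stay free and are averaged out by the
      -- kernel.
      have h := hrun.output_law (A ×ˢ Set.univ) (hA.prod MeasurableSet.univ) C hC
      simp only [Set.mem_prod, Set.mem_univ, and_true] at h
      rw [h]
      refine lintegral_congr_ae (ae_restrict_of_ae ?_)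
      filter_upwards [hX.ae_mem_support] with ω hω
      refine Finset.prod_congr rfl fun b _ => Finset.prod_congr rfl fun r _ => ?_
      simp only [hνdef]
      rw [hS.probPart_eq (resampledInput_mem_hullClass hs hω (J ω b))])
  have hXY : Measurable fun ω => ((fun i j => X i j ω : ∀ i, ℕ → E i), Y ω) :=
    hXm.prodMk hrun.measurable_output
  have hκm : Measurable fun x => outputKernel ν hν B R x (Prod.mk x ⁻¹' D) :=
    ProbabilityTheory.Kernel.measurable_kernel_prodMk_left hDm
  refine ⟨fun ω => outputKernel ν hν B R (fun i j => X i j ω)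
    (Prod.mk (fun i j => X i j ω) ⁻¹' D), hκm.comp hXm, fun ω => prob_le_one, ?_, ?_⟩
  · filter_upwards [hae] with ω hω
    rw [outputKernel_apply, outputLaw, ← hω]
    rfl
  · have h1 : μ {ω | δ ≤ t * |svbEstimator 1 (Y ω) - starVar ψ n s fun i j => X i j ω|}
        = μ ((fun ω => ((fun i j => X i j ω : ∀ i, ℕ → E i), Y ω)) ⁻¹' D) := by
      refine measure_congr ?_
      filter_upwards [hae] with ω hω
      refine propext ?_
      change δ ≤ _ ↔ δ ≤ _
      rw [← hω]
    rw [h1, ← Measure.map_apply hXY hDm, hlaw, Measure.compProd_apply hDm,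
      lintegral_map hκm hXm]

end OneSize

/-! ### Growth of the data and subsample sizes -/

section Sizes

variable {m : ℕ} {n : ℕ → Fin m → ℕ} {θ : ℕ → ℝ}

theorem BalancedData.eventually_pos (h : BalancedData n) : ∀ᶠ k in atTop, ∀ i, 0 < n k i :=
  eventually_all.2 fun i => (h.tendsto i).eventually_gt_atTop 0

theorem tendsto_mul_avgSize (h : Tendsto (fun k => θ k / (1 / avgSize (n k))) atTop atTop) :
    Tendsto (fun k => θ k * avgSize (n k)) atTop atTop := by
  simpa using h

/-- Balance bounds the average size by c times any single size, so θ n → ∞ passes to each input. -/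
theorem BalancedData.tendsto_mul_size (hm : 0 < m) (h : BalancedData n) (hθ : ∀ k, 0 < θ k)
    (hθn : Tendsto (fun k => θ k * avgSize (n k)) atTop atTop) (i : Fin m) :
    Tendsto (fun k => θ k * n k i) atTop atTop := by
  obtain ⟨c, hc, hcn⟩ := h.ratio
  have hm' : (0 : ℝ) < m := by exact_mod_cast hm
  refine tendsto_atTop_mono' _ ?_ (hθn.const_mul_atTop (inv_pos.2 hc))
  filter_upwards [hcn] with k hk
  have h1 : avgSize (n k) ≤ c * n k i := by
    rw [avgSize, div_le_iff₀ hm']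
    calc ∑ j, (n k j : ℝ) ≤ ∑ _j : Fin m, c * n k i := Finset.sum_le_sum fun j _ => hk j i
      _ = c * n k i * m := by simp; ring
  have := hθ k
  calc c⁻¹ * (θ k * avgSize (n k)) ≤ c⁻¹ * (θ k * (c * n k i)) := by gcongr
    _ = θ k * n k i := by field_simp

/-- Rounding is asymptotically invisible because θ n_i → ∞. The last bound converts a remainder of
order o_p(s⁻²) to the scale (θ n)⁻². -/
theorem BalancedData.tendsto_subsampleSize (hm : 0 < m) (h : BalancedData n) (hθ : ∀ k, 0 < θ k)
    (hθn : Tendsto (fun k => θ k * avgSize (n k)) atTop atTop) :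
    (∀ᶠ k in atTop, ∀ i, 0 < subsampleSize (θ k) (n k) i) ∧
    (∀ i, Tendsto (fun k => θ k * n k i / subsampleSize (θ k) (n k) i) atTop (𝓝 1)) ∧
    ∀ᶠ k in atTop, θ k * avgSize (n k) ≤ 2 * avgSize (subsampleSize (θ k) (n k)) := by
  have hi := h.tendsto_mul_size hm hθ hθn
  have hm' : (0 : ℝ) < m := by exact_mod_cast hm
  refine ⟨eventually_all.2 fun i => ?_, fun i => ?_, ?_⟩
  · filter_upwards [(hi i).eventually_ge_atTop 1] with k hk
    exact Nat.floor_pos.2 hk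
  · have h1 := (tendsto_nat_floor_div_atTop (R := ℝ)).comp (hi i)
    have h2 := h1.inv₀ one_ne_zero
    simpa [Function.comp_def, subsampleSize] using h2
  -- Each floor loses less than 1, so the average loses at most 1; this is at most half of θ n once
  -- θ n ≥ 2.
  · filter_upwards [hθn.eventually_ge_atTop 2] with k hk
    have h1 : θ k * avgSize (n k) ≤ avgSize (subsampleSize (θ k) (n k)) + 1 := by
      rw [avgSize, avgSize, ← mul_div_assoc, div_add_one hm'.ne', Finset.mul_sum]
      gcongr
      have : ∀ i : Fin m, θ k * n k i ≤ (subsampleSize (θ k) (n k) i : ℝ) + 1 := fun i =>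
        (Nat.lt_floor_add_one _).le
      refine (Finset.sum_le_sum fun i _ => this i).trans_eq ?_
      rw [Finset.sum_add_distrib]; simp
    linarith

end Sizes

/-! ### Limit of the conditional variance -/

section Limits

variable {m : ℕ} {E : Fin m → Type*} [∀ i, MeasurableSpace (E i)]
  [∀ i, TopologicalSpace (E i)]
  {F : ∀ i, Measure (E i)} [∀ i, IsProbabilityMeasure (F i)]
  {ψ : (∀ i, Measure (E i)) → ℝ} {g : ∀ i, (∀ i, Measure (E i)) → E i → ℝ}
  {Ω : Type*} [MeasurableSpace Ω] {μ : Measure Ω} [IsProbabilityMeasure μ]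
  {X : ∀ i, ℕ → Ω → E i} {n : ℕ → Fin m → ℕ}

/-- The empirical second moments of the estimated influence functions are consistent, and the
empirical fourth moments are bounded by a convergent random variable. -/
theorem influence_moments (hX : IsData μ F X) (hd : GateauxDifferentiable F ψ g)
    (hb : BalancedData n) (hσ : ∀ i, MemLp (g i F) 4 (F i))
    (h : ∀ i, Tendsto (fun k => ∫⁻ ω, ‖g i (empiricalInput (n k) fun i' j => X i' j ω) (X i 0 ω)
      - g i F (X i 0 ω)‖ₑ ^ 4 ∂μ) atTop (𝓝 0)) (i : Fin m) :
    Tendsto (fun p : ℕ × Ω => (∑ j : Fin (n p.1 i),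
      g i (empiricalInput (n p.1) fun i' j => X i' j p.2) (X i j p.2) ^ 2) / n p.1 i)
        (probFilter μ) (𝓝 (variance (g i F) (F i))) ∧
    ∃ (A : ℕ × Ω → ℝ) (a : ℝ), Tendsto A (probFilter μ) (𝓝 a) ∧ ∀ p : ℕ × Ω,
      (∑ j : Fin (n p.1 i),
        g i (empiricalInput (n p.1) fun i' j => X i' j p.2) (X i j p.2) ^ 4) / n p.1 i ≤ A p := by
  have hD := tendsto_avg_influence_sub hX hd hb.eventually_pos i (h i)
  have hG2 := hX.tendsto_avg (hb.tendsto i) i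
    (integrable_pow_of_memLp_four (hσ i) (k := 2) (by norm_num))
  have hG4 := hX.tendsto_avg (hb.tendsto i) i
    (integrable_pow_of_memLp_four (hσ i) (k := 4) (by norm_num))
  have hvar : variance (g i F) (F i) = ∫ x, g i F x ^ 2 ∂(F i) :=
    variance_of_integral_eq_zero (hσ i).aemeasurable
      (hd.centered F (fun i => self_mem_hullClass _) i)
  constructor
  · have hlim : Tendsto (fun p : ℕ × Ω =>
        2 * √((∑ j : Fin (n p.1 i), g i F (X i j p.2) ^ 2) / n p.1 i) *
          √√((∑ j : Fin (n p.1 i), (g i (empiricalInput (n p.1) fun i' j => X i' j p.2) (X i j p.2)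
            - g i F (X i j p.2)) ^ 4) / n p.1 i)
        + √((∑ j : Fin (n p.1 i), (g i (empiricalInput (n p.1) fun i' j => X i' j p.2) (X i j p.2)
            - g i F (X i j p.2)) ^ 4) / n p.1 i)) (probFilter μ) (𝓝 0) := by
      simpa using ((hG2.sqrt.const_mul 2).mul hD.sqrt.sqrt).add hD.sqrt
    have hdiff := squeeze_zero_norm (f := fun p : ℕ × Ω => (∑ j : Fin (n p.1 i),
      g i (empiricalInput (n p.1) fun i' j => X i' j p.2) (X i j p.2) ^ 2) / n p.1 i
        - (∑ j : Fin (n p.1 i), g i F (X i j p.2) ^ 2) / n p.1 i) (fun p : ℕ × Ω => abs_avg_sq_sub_le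
      (fun j : Fin (n p.1 i) => g i F (X i j p.2)) (fun j : Fin (n p.1 i) =>
        g i (empiricalInput (n p.1) fun i' j => X i' j p.2) (X i j p.2))) hlim
    have := hdiff.add hG2
    simpa [hvar] using this
  · exact ⟨_, _, (hG4.add hD).const_mul 8, fun p => avg_pow_four_le
      (fun j : Fin (n p.1 i) => g i F (X i j p.2)) (fun j : Fin (n p.1 i) =>
        g i (empiricalInput (n p.1) fun i' j => X i' j p.2) (X i j p.2))⟩

variable [∀ i, SecondCountableTopology (E i)] [∀ i, T1Space (E i)] [∀ i, BorelSpace (E i)]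
  {θ : ℕ → ℝ}

/-- The variance conditional on the data, suitably scaled, converges in probability, and the
scaled fourth central moment is bounded by a convergent random variable. -/
theorem tendsto_starVar (hm : 0 < m) (hX : IsData μ F X) (hθ : ∀ k, 0 < θ k)
    (hb : BalancedData n) (hd : GateauxDifferentiable F ψ g) (ht : SmoothAtTruth μ F ψ g X n)
    (he : SmoothAtEmpirical μ F ψ g X n fun k => subsampleSize (θ k) (n k))
    (hθn : Tendsto (fun k => θ k * avgSize (n k)) atTop atTop) :
    Tendsto (fun p : ℕ × Ω => θ p.1 / linearVar F g (n p.1) *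
      starVar ψ (n p.1) (subsampleSize (θ p.1) (n p.1)) fun i j => X i j p.2)
        (probFilter μ) (𝓝 1) ∧
    ∃ (A : ℕ × Ω → ℝ) (a : ℝ), Tendsto A (probFilter μ) (𝓝 a) ∧ ∀ᶠ p in probFilter μ,
      (θ p.1 / linearVar F g (n p.1)) ^ 2 *
        (starMoment4 ψ (n p.1) (subsampleSize (θ p.1) (n p.1)) fun i j => X i j p.2) ≤ A p := by
  obtain ⟨hs, hratio, hsN⟩ := hb.tendsto_subsampleSize hm hθ hθn
  obtain ⟨C, hC, hCv⟩ := exists_inv_linearVar_le hm ht.nondegenerate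
  have hσ := ht.nondegenerate
  have M := influence_moments hX hd hb ht.moment4 he.influence
  choose M2 A a hA hMA using M
  set s : ℕ → Fin m → ℕ := fun k => subsampleSize (θ k) (n k) with hsdef
  set x : ℕ × Ω → ∀ i, ℕ → E i := fun p i j => X i j p.2 with hx
  set t : ℕ → ℝ := fun k => θ k / linearVar F g (n k) with htdef
  set s2 : Fin m → ℕ × Ω → ℝ := fun i p =>
    (∑ j : Fin (n p.1 i), g i (empiricalInput (n p.1) (x p)) (x p i j) ^ 2) / n p.1 i with hs2
  set s4 : Fin m → ℕ × Ω → ℝ := fun i p =>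
    (∑ j : Fin (n p.1 i), g i (empiricalInput (n p.1) (x p)) (x p i j) ^ 4) / n p.1 i with hs4
  set η : ℕ × Ω → ℝ := fun p => starMean fun J : ResampleIndex (n p.1) (s p.1) =>
    remainder ψ g (empiricalInput (n p.1) (x p)) (mixedInput Finset.univ (x p) J) ^ 4 with hη
  set r : Fin m → ℕ × Ω → ℝ := fun i p => θ p.1 * n p.1 i / s p.1 i with hr
  have hr1 : ∀ i, Tendsto (r i) (probFilter μ) (𝓝 1) := fun i =>
    (hratio i).comp tendsto_fst_probFilter
  have hη0 : ∀ p, 0 ≤ η p := fun p => by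
    simp only [hη, starMean]; positivity
  have hrem : Tendsto (fun p : ℕ × Ω => avgSize (s p.1) ^ 2 * η p) (probFilter μ) (𝓝 0) := by
    have h := he.remainder_small Finset.univ
    rw [tendstoInMeasure_iff_probFilter] at h
    exact h
  have hgood : ∀ᶠ p : ℕ × Ω in probFilter μ, (∀ i, 0 < n p.1 i) ∧ (∀ i, 0 < s p.1 i) ∧
      θ p.1 * avgSize (n p.1) ≤ 2 * avgSize (s p.1) ∧ ∀ i j, x p i j ∈ (F i).support := by
    filter_upwards [tendsto_fst_probFilter.eventually hb.eventually_pos,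
      tendsto_fst_probFilter.eventually hs, tendsto_fst_probFilter.eventually hsN,
      eventually_probFilter_of_ae (P := fun _ ω => ∀ i j, X i j ω ∈ (F i).support)
        (Eventually.of_forall fun _ => hX.ae_mem_support)] with p h1 h2 h3 h4
    exact ⟨h1, h2, h3, h4⟩
  -- t = θ/v ≤ C θ n ≤ 2 C s, so the remainder stays negligible at scale t².
  have htη : Tendsto (fun p : ℕ × Ω => t p.1 ^ 2 * η p) (probFilter μ) (𝓝 0) := by
    have hup : Tendsto (fun p : ℕ × Ω => (2 * C) ^ 2 * (avgSize (s p.1) ^ 2 * η p))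
        (probFilter μ) (𝓝 0) := by simpa using hrem.const_mul ((2 * C) ^ 2)
    refine squeeze_zero' (Eventually.of_forall fun p => mul_nonneg (sq_nonneg _) (hη0 p)) ?_ hup
    filter_upwards [hgood] with p ⟨h1, h2, h3, h4⟩
    have hv := linearVar_pos hm hσ h1
    have hθp := hθ p.1
    have htp : t p.1 ≤ 2 * C * avgSize (s p.1) := by
      calc t p.1 = θ p.1 * (1 / linearVar F g (n p.1)) := by simp only [htdef]; ring
        _ ≤ θ p.1 * (C * avgSize (n p.1)) := by gcongr; exact hCv _ h1
        _ = C * (θ p.1 * avgSize (n p.1)) := by ring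
        _ ≤ C * (2 * avgSize (s p.1)) := by gcongr
        _ = _ := by ring
    have htp0 : 0 ≤ t p.1 := by simp only [htdef]; positivity
    calc t p.1 ^ 2 * η p ≤ (2 * C * avgSize (s p.1)) ^ 2 * η p := by
          gcongr; exact hη0 p
      _ = _ := by ring
  -- The scaled linear variance becomes a sum of (σ̂_i² r_i) · 1/(n_i v) with r_i → 1. Since the
  -- weights σ_i²/(n_i v) add up to 1 exactly, its error tends to 0 by bounding 1/(n_i v) ≤ 1/σ_i²,
  -- even if the weights do not converge.
  have hfac : ∀ p : ℕ × Ω, (∀ i, 0 < n p.1 i) → ∀ i,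
      t p.1 / s p.1 i = r i p * (1 / (n p.1 i * linearVar F g (n p.1))) := fun p h1 i => by
    have hv := linearVar_pos hm hσ h1
    have hni : (n p.1 i : ℝ) ≠ 0 := by exact_mod_cast (h1 i).ne'
    simp only [htdef, hr]
    field_simp
  have hw : ∀ p : ℕ × Ω, (∀ i, 0 < n p.1 i) → ∀ i,
      1 / (n p.1 i * linearVar F g (n p.1)) ≤ 1 / variance (g i F) (F i) := fun p h1 i =>
    one_div_le_one_div_of_le (hσ i) (variance_le_mul_linearVar hσ h1 i)
  set VL : ℕ × Ω → ℝ := fun p => ∑ i, s2 i p / s p.1 i with hVL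
  have hVL1 : Tendsto (fun p : ℕ × Ω => t p.1 * VL p) (probFilter μ) (𝓝 1) := by
    have hup : Tendsto (fun p : ℕ × Ω => ∑ i, |s2 i p * r i p - variance (g i F) (F i)|
        * (1 / variance (g i F) (F i))) (probFilter μ) (𝓝 0) := by
      have : Tendsto (fun p : ℕ × Ω => ∑ i, |s2 i p * r i p - variance (g i F) (F i)|
        * (1 / variance (g i F) (F i))) (probFilter μ) (𝓝 (∑ i : Fin m, 0)) := by
        refine tendsto_finsetSum _ fun i _ => ?_
        have h1 := (((M2 i).mul (hr1 i)).sub_const (variance (g i F) (F i))).abs.mul_const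
          (1 / variance (g i F) (F i))
        simpa using h1
      simpa using this
    rw [tendsto_iff_dist_tendsto_zero]
    refine squeeze_zero' (Eventually.of_forall fun p => dist_nonneg) ?_ hup
    filter_upwards [hgood] with p ⟨h1, h2, h3, h4⟩
    have hv := linearVar_pos hm hσ h1
    have hone : ∑ i, variance (g i F) (F i) * (1 / (n p.1 i * linearVar F g (n p.1))) = 1 := by
      have : ∀ i, variance (g i F) (F i) * (1 / (n p.1 i * linearVar F g (n p.1)))
          = variance (g i F) (F i) / n p.1 i / linearVar F g (n p.1) := fun i => by
        rw [mul_one_div, div_div]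
      simp_rw [this]
      rw [← Finset.sum_div]
      exact div_self hv.ne'
    have hexp : t p.1 * VL p - 1 = ∑ i, (s2 i p * r i p - variance (g i F) (F i))
        * (1 / (n p.1 i * linearVar F g (n p.1))) := by
      simp_rw [sub_mul]
      rw [Finset.sum_sub_distrib, hone, hVL, Finset.mul_sum]
      congr 1
      refine Finset.sum_congr rfl fun i _ => ?_
      rw [mul_assoc, ← hfac p h1 i]
      ring
    rw [Real.dist_eq, hexp]
    refine (Finset.abs_sum_le_sum_abs _ _).trans (Finset.sum_le_sum fun i _ => ?_)
    rw [abs_mul]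
    have h5 : 0 ≤ 1 / (n p.1 i * linearVar F g (n p.1)) := by positivity
    rw [abs_of_nonneg h5]
    exact mul_le_mul_of_nonneg_left (hw p h1 i) (abs_nonneg _)
  have hexpand : ∀ᶠ p : ℕ × Ω in probFilter μ,
      |starVar ψ (n p.1) (s p.1) (x p) - VL p| ≤ 2 * √(VL p) * √√(η p) + √(η p) ∧
      starMoment4 ψ (n p.1) (s p.1) (x p)
        ≤ 128 * (3 * (∑ i, √(s4 i p) / s p.1 i) ^ 2 + η p) := by
    filter_upwards [hgood] with p ⟨h1, h2, h3, h4⟩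
    have : ∀ i, NeZero (n p.1 i) := fun i => ⟨(h1 i).ne'⟩
    exact starVar_expansion hd h2 h4
  constructor
  · have hup : Tendsto (fun p : ℕ × Ω => 2 * √(t p.1 * VL p) * √√(t p.1 ^ 2 * η p)
        + √(t p.1 ^ 2 * η p)) (probFilter μ) (𝓝 0) := by
      simpa using ((hVL1.sqrt.const_mul 2).mul htη.sqrt.sqrt).add htη.sqrt
    have hdiff : Tendsto (fun p : ℕ × Ω => t p.1 * starVar ψ (n p.1) (s p.1) (x p)
        - t p.1 * VL p) (probFilter μ) (𝓝 0) := by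
      refine squeeze_zero_norm' ?_ hup
      filter_upwards [hgood, hexpand] with p ⟨h1, h2, h3, h4⟩ ⟨h5, _⟩
      have hv := linearVar_pos hm hσ h1
      have htp0 : 0 ≤ t p.1 := by
        have := hθ p.1
        simp only [htdef]; positivity
      rw [← mul_sub, Real.norm_eq_abs, abs_mul, abs_of_nonneg htp0]
      refine (mul_le_mul_of_nonneg_left h5 htp0).trans_eq ?_
      -- The error bound is homogeneous: t √VL √√η = √(t VL) √√(t² η).
      rw [Real.sqrt_mul htp0, Real.sqrt_mul (sq_nonneg _), Real.sqrt_sq htp0, Real.sqrt_mul htp0]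
      linear_combination (-2 * √(VL p) * √√(η p)) * Real.mul_self_sqrt htp0
    have := hdiff.add hVL1
    simpa using this
  · refine ⟨fun p => 128 * (3 * (∑ i, √(A i p) * (r i p * (1 / variance (g i F) (F i)))) ^ 2
      + t p.1 ^ 2 * η p), _, (((tendsto_finsetSum _ fun i _ => (hA i).sqrt.mul
        ((hr1 i).mul_const _)).pow 2).const_mul 3 |>.add htη).const_mul 128, ?_⟩
    filter_upwards [hgood, hexpand] with p ⟨h1, h2, h3, h4⟩ ⟨_, h5⟩
    have hv := linearVar_pos hm hσ h1
    have hθp := hθ p.1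
    have htp0 : 0 ≤ t p.1 := by simp only [htdef]; positivity
    calc t p.1 ^ 2 * starMoment4 ψ (n p.1) (s p.1) (x p)
        ≤ t p.1 ^ 2 * (128 * (3 * (∑ i, √(s4 i p) / s p.1 i) ^ 2 + η p)) := by gcongr
      _ = 128 * (3 * (∑ i, √(s4 i p) * (t p.1 / s p.1 i)) ^ 2 + t p.1 ^ 2 * η p) := by
          have : ∑ i, √(s4 i p) * (t p.1 / s p.1 i) = t p.1 * ∑ i, √(s4 i p) / s p.1 i := by
            rw [Finset.mul_sum]
            exact Finset.sum_congr rfl fun i _ => by ring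
          rw [this]; ring
      _ ≤ _ := by
          gcongr with i
          · exact hMA i p
          · rw [hfac p h1 i]
            have : 0 ≤ r i p := by simp only [hr]; positivity
            exact mul_le_mul_of_nonneg_left (hw p h1 i) this

end Limits

end InputUncertainty

/-! ### Assembly: relative consistency of the estimator -/

theorem theorem2 {m : ℕ} (hm : 0 < m) {E : Fin m → Type*}
    [∀ i, TopologicalSpace (E i)] [∀ i, SecondCountableTopology (E i)] [∀ i, T1Space (E i)]
    [∀ i, MeasurableSpace (E i)] [∀ i, BorelSpace (E i)]
    (F : ∀ i, Measure (E i)) [∀ i, IsProbabilityMeasure (F i)]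
    -- performance measure, law of one simulation replication, influence functions
    (ψ : (∀ i, Measure (E i)) → ℝ) (S : (∀ i, Measure (E i)) → Measure ℝ)
    (g : ∀ i, (∀ i, Measure (E i)) → E i → ℝ)
    (hS : IsSimulator F ψ S)
    -- the data
    {Ω : Type*} [MeasurableSpace Ω] (μ : Measure Ω) [IsProbabilityMeasure μ]
    (X : ∀ i, ℕ → Ω → E i) (hX : IsData μ F X)
    -- data sizes and parameters of the algorithm
    (n : ℕ → Fin m → ℕ) (θ : ℕ → ℝ) (B R : ℕ → ℕ)
    (hθ : ∀ k, 0 < θ k ∧ θ k ≤ 1) (hB : ∀ k, 2 ≤ B k) (hR : ∀ k, 2 ≤ R k)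
    -- the regularity assumptions
    (h_balanced : BalancedData n)
    (h_diff : GateauxDifferentiable F ψ g)
    (h_truth : SmoothAtTruth μ F ψ g X n)
    (h_empirical : SmoothAtEmpirical μ F ψ g X n fun k => subsampleSize (θ k) (n k))
    (h_var_emp : EmpiricalVarConverges μ F ψ S X n)
    (h_var_sim : BootstrapVarConverges μ ψ S X n fun k => subsampleSize (θ k) (n k))
    (h_mu4 : BootstrapMoment4Bounded μ ψ S X n fun k => subsampleSize (θ k) (n k))
    -- `B = ω(1)`, `B R² = ω((θ n)²)`, `θ = ω(1/n)`
    (hB_order : Tendsto (fun k => (B k : ℝ)) atTop atTop)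
    (hBR_order : Tendsto
      (fun k => ((B k : ℝ) * (R k : ℝ) ^ 2) / (θ k * avgSize (n k)) ^ 2) atTop atTop)
    (hθ_order : Tendsto (fun k => θ k / (1 / avgSize (n k))) atTop atTop)
    -- the draws and the replications of the algorithm for each `k`
    (J : ∀ k, Ω → Fin (B k) → ResampleIndex (n k) (subsampleSize (θ k) (n k)))
    (Y : ∀ k, Ω → Fin (B k) → Fin (R k) → ℝ)
    (h_run : ∀ᶠ k in atTop, IsRun μ S X (J k) (Y k)) :
    TendstoInMeasure μ
      (fun k ω => svbEstimator (θ k) (Y k ω) / inputVar μ ψ X (n k))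
      atTop (fun _ => (1 : ℝ)) := by
  have hn := h_balanced.eventually_pos
  have hθ0 : ∀ k, 0 < θ k := fun k => (hθ k).1
  have hθn := tendsto_mul_avgSize hθ_order
  obtain ⟨hs, -, -⟩ := h_balanced.tendsto_subsampleSize hm hθ0 hθn
  obtain ⟨hstar, A, a, hA, hMA⟩ := tendsto_starVar hm hX hθ0 h_balanced h_diff h_truth h_empirical hθn
  obtain ⟨C, hC, hCv⟩ := exists_inv_linearVar_le hm h_truth.nondegenerate
  set s : ℕ → Fin m → ℕ := fun k => subsampleSize (θ k) (n k) with hsdef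
  set t : ℕ → ℝ := fun k => θ k / linearVar F g (n k) with htdef
  set u : ℕ → Ω → ℝ≥0∞ := fun k ω => starMeanENN fun J : ResampleIndex (n k) (s k) =>
    simMoment4 ψ S (resampledInput (fun i j => X i j ω) J) with hudef
  have hu : IsBigOpOne μ u := by
    have h := h_mu4 Finset.univ
    simp only [mixedInput_univ] at h
    exact h
  have htpos : ∀ᶠ k in atTop, 0 < t k := by
    filter_upwards [hn] with k hk
    exact div_pos (hθ0 k) (linearVar_pos hm h_truth.nondegenerate hk)
  have hBinv : Tendsto (fun k => 1 / (B k : ℝ)) atTop (𝓝 0) := by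
    simp_rw [one_div]
    exact hB_order.inv_tendsto_atTop
  -- As t ≤ C θ n, this is where B R²/(θ n)² → ∞ enters.
  have hw : Tendsto (fun k => t k ^ 2 / ((B k : ℝ) * (R k : ℝ) ^ 2)) atTop (𝓝 0) := by
    have hup : Tendsto (fun k => C ^ 2 * (((B k : ℝ) * (R k : ℝ) ^ 2)
        / (θ k * avgSize (n k)) ^ 2)⁻¹) atTop (𝓝 0) := by
      simpa using hBR_order.inv_tendsto_atTop.const_mul (C ^ 2)
    refine squeeze_zero' (Eventually.of_forall fun k => by positivity) ?_ hup
    filter_upwards [hn, htpos] with k hk htk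
    have hθk := hθ0 k
    have h1 : t k ≤ C * (θ k * avgSize (n k)) := by
      calc t k = θ k * (1 / linearVar F g (n k)) := by simp only [htdef]; ring
        _ ≤ θ k * (C * avgSize (n k)) := by gcongr; exact hCv _ hk
        _ = _ := by ring
    calc t k ^ 2 / ((B k : ℝ) * (R k : ℝ) ^ 2)
        ≤ (C * (θ k * avgSize (n k))) ^ 2 / ((B k : ℝ) * (R k : ℝ) ^ 2) := by gcongr
      _ = _ := by rw [inv_div]; ring
  obtain ⟨hufin, hulim⟩ := hu.mul_tendsto_zero hw
  have hBp : Tendsto (fun p : ℕ × Ω => 1 / (B p.1 : ℝ)) (probFilter μ) (𝓝 0) :=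
    hBinv.comp tendsto_fst_probFilter
  have hdev : Tendsto (fun p : ℕ × Ω => t p.1 * |svbEstimator 1 (Y p.1 p.2)
      - starVar ψ (n p.1) (s p.1) fun i j => X i j p.2|) (probFilter μ) (𝓝 0) := by
    rw [Metric.tendsto_nhds]
    intro δ hδ
    rw [eventually_probFilter]
    -- The conditional deviation probabilities exist only for large k, when all sizes are positive
    -- and the run is valid; other k receive the dummy value 0, so that one sequence can be chosen.
    have hq : ∀ k, ∃ q : Ω → ℝ≥0∞, ((∀ i, 0 < n k i) ∧ (∀ i, 0 < s k i) ∧ IsRun μ S X (J k) (Y k) →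
      Measurable q ∧ (∀ ω, q ω ≤ 1) ∧
      (∀ᵐ ω ∂μ, q ω = outputLaw S (n k) (s k) (B k) (R k) (fun i j => X i j ω)
        {y | δ ≤ t k * |svbEstimator 1 y - starVar ψ (n k) (s k) fun i j => X i j ω|}) ∧
      μ {ω | δ ≤ t k * |svbEstimator 1 (Y k ω) - starVar ψ (n k) (s k) fun i j => X i j ω|}
        = ∫⁻ ω, q ω ∂μ) := by
      intro k
      by_cases hk : (∀ i, 0 < n k i) ∧ (∀ i, 0 < s k i) ∧ IsRun μ S X (J k) (Y k)
      · have : ∀ i, NeZero (n k i) := fun i => ⟨(hk.1 i).ne'⟩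
        obtain ⟨q, hq⟩ := exists_measure_deviation_eq hS hX hk.2.1 hk.2.2 (t k) δ
        exact ⟨q, fun _ => hq⟩
      · exact ⟨0, fun h => absurd h hk⟩
    choose q hq using hq
    have hev : ∀ᶠ k in atTop, (∀ i, 0 < n k i) ∧ (∀ i, 0 < s k i) ∧ IsRun μ S X (J k) (Y k) := by
      filter_upwards [hn, hs, h_run] with k h1 h2 h3
      exact ⟨h1, h2, h3⟩
    have hqlim : Tendsto (fun p : ℕ × Ω => q p.1 p.2) (probFilter μ) (𝓝 0) := by
      have hup : Tendsto (fun p : ℕ × Ω => ENNReal.ofReal ((8 / δ + 8 / δ ^ 2) *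
          (1 / (B p.1 : ℝ) + 8 * A p * (1 / (B p.1 : ℝ))
            + 28 * (t p.1 ^ 2 / ((B p.1 : ℝ) * (R p.1 : ℝ) ^ 2) * (u p.1 p.2).toReal))))
          (probFilter μ) (𝓝 0) := by
        have h := ((hBp.add ((hA.const_mul 8).mul hBp)).add (hulim.const_mul 28)).const_mul
          (8 / δ + 8 / δ ^ 2)
        have h' := ENNReal.tendsto_ofReal h
        simpa using h'
      refine tendsto_of_tendsto_of_tendsto_of_le_of_le' tendsto_const_nhds hup
        (Eventually.of_forall fun _ => zero_le) ?_
      have hae : ∀ᶠ p : ℕ × Ω in probFilter μ, q p.1 p.2 = outputLaw S (n p.1) (s p.1) (B p.1)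
          (R p.1) (fun i j => X i j p.2) {y | δ ≤ t p.1 * |svbEstimator 1 y
            - starVar ψ (n p.1) (s p.1) fun i j => X i j p.2|} :=
        eventually_probFilter_of_ae (P := fun k ω => q k ω = outputLaw S (n k) (s k) (B k) (R k)
          (fun i j => X i j ω) {y | δ ≤ t k * |svbEstimator 1 y
            - starVar ψ (n k) (s k) fun i j => X i j ω|}) (hev.mono fun k hk => (hq k hk).2.2.1)
      have hsupp : ∀ᶠ p : ℕ × Ω in probFilter μ, ∀ i j, X i j p.2 ∈ (F i).support :=
        eventually_probFilter_of_ae (P := fun _ ω => ∀ i j, X i j ω ∈ (F i).support)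
          (Eventually.of_forall fun _ => hX.ae_mem_support)
      filter_upwards [hae, hsupp, hufin, hMA, tendsto_fst_probFilter.eventually hev,
        tendsto_fst_probFilter.eventually htpos] with p h1 h2 h3 h4 h5 h6
      have : ∀ i, NeZero (n p.1 i) := fun i => ⟨(h5.1 i).ne'⟩
      rw [h1]
      refine (conditional_concentration hS h5.2.1 h2 (hB p.1) (hR p.1) h3 h6 hδ).trans
        (ENNReal.ofReal_le_ofReal ?_)
      rw [mul_div_assoc 8, mul_assoc 8 (A p), mul_one_div (A p)]
      gcongr
    -- Passes from conditional to unconditional probabilities of deviation.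
    have hlim := tendsto_lintegral_of_probFilter (hev.mono fun k hk => (hq k hk).1)
      (hev.mono fun k hk => (hq k hk).2.1) hqlim
    refine hlim.congr' ?_
    filter_upwards [hev, htpos] with k hk htk
    rw [← (hq k hk).2.2.2]
    congr 1
    ext ω
    simp only [Set.mem_ofPred_eq, dist_zero_right, not_lt, Real.norm_eq_abs, abs_mul, abs_abs,
      abs_of_pos htk]
  have hdev' : Tendsto (fun p : ℕ × Ω => t p.1 * (svbEstimator 1 (Y p.1 p.2)
      - starVar ψ (n p.1) (s p.1) fun i j => X i j p.2)) (probFilter μ) (𝓝 0) := by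
    refine squeeze_zero_norm' ?_ hdev
    filter_upwards [tendsto_fst_probFilter.eventually htpos] with p hp
    rw [Real.norm_eq_abs, abs_mul, abs_of_pos hp]
  have hest : Tendsto (fun p : ℕ × Ω => t p.1 * svbEstimator 1 (Y p.1 p.2)) (probFilter μ) (𝓝 1) := by
    have h := hdev'.add hstar
    simp only [zero_add] at h
    refine h.congr fun p => ?_
    ring
  have hI : Tendsto (fun p : ℕ × Ω => inputVar μ ψ X (n p.1) / linearVar F g (n p.1))
      (probFilter μ) (𝓝 1) :=
    (tendsto_inputVar_div_linearVar hm hS hX hn h_diff h_truth).comp tendsto_fst_probFilter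
  rw [tendstoInMeasure_iff_probFilter]
  -- Estimator and input variance are each asymptotic to v; the common factor v cancels in the
  -- quotient.
  have hfinal := hest.div hI one_ne_zero
  rw [div_one] at hfinal
  refine hfinal.congr' ?_
  filter_upwards [tendsto_fst_probFilter.eventually hn] with p hp
  have hv := linearVar_pos hm h_truth.nondegenerate hp
  have hsvb : svbEstimator (θ p.1) (Y p.1 p.2) = θ p.1 * svbEstimator 1 (Y p.1 p.2) := by
    simp only [svbEstimator, one_mul]
  simp only [Pi.div_apply, htdef]
  rw [hsvb, div_mul_eq_mul_div, div_div_div_cancel_right₀ hv.ne']
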